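/- Let $n\ge 1$ be an integer, $s>5/2$, and let $u_0\in H^s(\mathbb R)$ be real-valued with $m_0:=u_0-u_0''\ge 0$ on $\mathbb R$. Let $T>0$ and let $u\in C([0,T);H^s(\mathbb R))\cap C^1([0,T);H^{s-1}(\mathbb R))$ be a strong solution with initial data $u(0,\cdot)=u_0$ of the generalized higher-order Camassa--Holm equation $$m_t+(u^2-u_x^2)^{n-1}u_x\,m+\partial_x\big[(u^2-u_x^2)^{n-1}u\,m\big]=0,\qquad m=u-u_{xx},$$ where the equation holds in the sense of distributions in $x$ for every $t\in[0,T)$ and each $u(t,\cdot)$ is identified with its continuous representative. Put $$H_1(u)=\int_{\mathbb R}(u^2+u_x^2)\,dx,\qquad H_2(u)=\int_{\mathbb R}\Big(u^{2n+1}+\sum_{k=1}^n\frac{(-1)^{k+1}}{2k-1}\binom nk u^{2n-2k+1}u_x^{2k}\Big)dx,$$ $$c_1=\frac12+\sum_{j=1}^n(-1)^{j+1}\frac{2j-3}{2(2j-1)}\binom nj .$$ Then for every $t\in[0,T)$ the maximum $M(t)=\max_{x\in\mathbb R}u(t,x)$ is attained, and $$\frac{(2n-1)(2-c_1)}{2n+1}M(t)^{2n+1}-\frac{2-c_1}{2}M(t)^{2n-1}H_1(u(t,\cdot))+H_2(u(t,\cdot))\le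 0 .$$ -/

import Mathlib

noncomputable section

open MeasureTheory Set TemperedDistribution
open scoped SchwartzMap ContDiff

namespace HOCH

/-- `BesselLift s f F`: the real function `f` lies in `L²(ℝ)` and, as a tempered distribution, its
Bessel potential of order `s` is the `L²` function `F`.  So `f ∈ H^s(ℝ)` if and only if such an `F`
exists; `F` is then unique, `f ↦ F` is linear, and `‖F‖_{L²}` is the norm of `f` in `H^s` (with the
weight `(1 + ξ²)^s`, `ξ` the frequency in Mathlib's normalization; an equivalent norm). -/
def BesselLift (s : ℝ) (f : ℝ → ℝ) (F : Lp ℂ 2 (volume : Measure ℝ)) : Prop :=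
  ∃ hf : MemLp (fun x => (f x : ℂ)) 2 (volume : Measure ℝ),
    besselPotential ℝ ℂ s (hf.toLp : 𝓢'(ℝ, ℂ)) = (F : 𝓢'(ℝ, ℂ))

/-- `f ∈ H^s(ℝ)`, for `s ≥ 0` (functions in `L²` only). -/
def MemHs (s : ℝ) (f : ℝ → ℝ) : Prop :=
  ∃ hf : MemLp (fun x => (f x : ℂ)) 2 (volume : Measure ℝ),
    MemSobolev s 2 (hf.toLp : 𝓢'(ℝ, ℂ))

/-- `u ∈ C^k([0,T); H^s(ℝ))`, where `u t` is the function `u(t, ·)`. The space `H^s` is carried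
isometrically onto `L²` by the Bessel potential, so this is `C^k` regularity of the lifted curve. -/
def CurveInHs (k : ℕ) (T s : ℝ) (u : ℝ → ℝ → ℝ) : Prop :=
  ∃ U : ℝ → Lp ℂ 2 (volume : Measure ℝ),
    ContDiffOn ℝ k U (Ico 0 T) ∧ ∀ t ∈ Ico 0 T, BesselLift s (u t) (U t)

/-- The momentum density `m = f - f_xx`. -/
def momentum (f : ℝ → ℝ) (x : ℝ) : ℝ := f x - deriv (deriv f) x

/-- The factor `(f² - f_x²)^(n-1)`. -/
def factor (n : ℕ) (f : ℝ → ℝ) (x : ℝ) : ℝ := (f x ^ 2 - deriv f x ^ 2) ^ (n - 1)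

/-- `u_t(t, x)` for a function on `[0,T) × ℝ` (one-sided at `t = 0`). -/
def timeDeriv (T : ℝ) (u : ℝ → ℝ → ℝ) (t x : ℝ) : ℝ :=
  derivWithin (fun τ => u τ x) (Ico 0 T) t

/-- `u` is a strong solution on `[0,T)` of the Cauchy problem
`m_t + (u² - u_x²)^(n-1) u_x m + ∂_x [(u² - u_x²)^(n-1) u m] = 0`, `m = u - u_xx`, `u(0,·) = u₀`,
in the class `C([0,T); H^s) ∩ C¹([0,T); H^(s-1))`. Each `u t` is the continuous representative of
its class. For `s > 5/2` the functions `u`, `u_x`, `u_xx`, `u_t` are then classical and continuous,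
while `m_t` and `∂_x [...]` are distributions in `x` at each time, and so is the equation. -/
structure IsStrongSolution (n : ℕ) (s T : ℝ) (u₀ : ℝ → ℝ) (u : ℝ → ℝ → ℝ) : Prop where
  continuous : ∀ t ∈ Ico 0 T, Continuous (u t)
  regularity : CurveInHs 0 T s u
  regularity_time : CurveInHs 1 T (s - 1) u
  initial : u 0 = u₀
  equation : ∀ t ∈ Ico 0 T, ∀ φ : ℝ → ℝ, ContDiff ℝ ∞ φ → HasCompactSupport φ →
    ∫ x, (timeDeriv T u t x * (φ x - deriv (deriv φ) x)
      + factor n (u t) x * deriv (u t) x * momentum (u t) x * φ x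
      - factor n (u t) x * u t x * momentum (u t) x * deriv φ x) = 0

/-- `H₁(f) = ∫ (f² + f_x²) dx`. -/
def H₁ (f : ℝ → ℝ) : ℝ := ∫ x, (f x ^ 2 + deriv f x ^ 2)

/-- `H₂(f) = ∫ (f^(2n+1) + ∑_{k=1}^n (-1)^(k+1)/(2k-1) C(n,k) f^(2n-2k+1) f_x^(2k)) dx`. -/
def H₂ (n : ℕ) (f : ℝ → ℝ) : ℝ :=
  ∫ x, (f x ^ (2 * n + 1) + ∑ k ∈ Finset.Icc 1 n,
    (-1 : ℝ) ^ (k + 1) / (2 * (k : ℝ) - 1) * (n.choose k : ℝ)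
      * f x ^ (2 * n - 2 * k + 1) * deriv f x ^ (2 * k))

/-- `c₁ = 1/2 + ∑_{j=1}^n (-1)^(j+1) (2j-3)/(2(2j-1)) C(n,j)`. -/
def c₁ (n : ℕ) : ℝ :=
  1 / 2 + ∑ j ∈ Finset.Icc 1 n,
    (-1 : ℝ) ^ (j + 1) * ((2 * (j : ℝ) - 3) / (2 * (2 * (j : ℝ) - 1))) * (n.choose j : ℝ)

end HOCH

end

noncomputable section

open MeasureTheory Set TemperedDistribution FourierTransform Real Filter Topology
open scoped SchwartzMap ContDiff

namespace HOCH

/-! Two facts carry the proof: `m ≥ 0` persists in time, and for a fixed function with `m ≥ 0` the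
inequality is an integrated pointwise bound.

Static part. If `m = f - f'' ≥ 0` then `|f'| ≤ f`. The integrand of `H₂` is homogeneous: it equals
`u^(2n+1) g(v/u)` with `g = profile n`, and `g'' = 2n(1 - w²)^(n-1)`. Thus `g'` is concave on
`[0,1]`, with `g'(0) = 0` and `g'(1) = g(1) = 2 - c₁ =: a`, so `g'(w) ≥ a w` and `g(w) ≤ (a/2)(1 +
w²)` for `|w| ≤ 1` (`profile_le`). Adding the nonnegative term `(a/2)(M^(2n-1) - u^(2n-1))(u ± v)²`
replaces `u^(2n-1)` by `M^(2n-1)`, at the cost of an exact derivative (`density_le_of_le`). With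
sign `+` to the right of the maximum point and `-` to the left, the exact derivatives integrate to
the `M^(2n+1)` term (`max_inequality`). The peakon profile `M exp(-|x - ξ|)` makes these pointwise
bounds equalities.

Dynamic part. The equation reads `m_t + (b m)_x + c m = 0` with `b = (u² - u_x²)^(n-1) u` and `c =
(u² - u_x²)^(n-1) u_x`, but `m` is only Hölder continuous in `x`. The mollified `w = m * ρ_ε` is
differentiable in `t` and `x`, and since `b` is Lipschitz the commutator gives `|w_t + b w_x| ≤
K(|w| + 2θ)`, where `θ` bounds the oscillation of `m` at scale `ε` and `K` does not depend on `ε`. A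
minimum principle (`neg_mul_exp_le_of_transport`) bounds `w` below by a multiple of `-θ`, and `ε →
0` gives `m ≥ 0`. The bounds needed, uniform on `[0,τ]` for `τ < T`, come from `H^s ⊂ C^{2,α}` for
`s > 5/2`. -/

/-! ### Sobolev embedding through Fourier inversion. -/

/-- The reflected Fourier transform of the function of `H^s` whose Bessel potential is `F`. -/
def symbol (s : ℝ) (F : Lp ℂ 2 (volume : Measure ℝ)) (ξ : ℝ) : ℂ :=
  (((1 + ξ ^ 2) ^ (-s / 2) : ℝ) : ℂ) * (𝓕 F : Lp ℂ 2 (volume : Measure ℝ)) (-ξ)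

theorem continuous_bracket_rpow (r : ℝ) : Continuous fun ξ : ℝ => (1 + ξ ^ 2) ^ r := by
  refine Continuous.rpow_const (by fun_prop) fun ξ => Or.inl ?_
  positivity

/-- The square is `(1 + ξ²)^(-r)`, integrable on the line because `2r > 1`. This is the half
derivative lost in the embedding. -/
theorem memLp_bracket_rpow {r : ℝ} (hr : 1 / 2 < r) :
    MemLp (fun ξ : ℝ => (1 + ξ ^ 2) ^ (-r / 2)) 2 := by
  rw [memLp_two_iff_integrable_sq (continuous_bracket_rpow _).aestronglyMeasurable]
  have h := integrable_rpow_neg_one_add_norm_sq (E := ℝ) (μ := volume) (r := 2 * r)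
    (by simp; linarith)
  refine h.congr (Filter.Eventually.of_forall fun ξ => ?_)
  simp only [norm_eq_abs, sq_abs]
  rw [← Real.rpow_mul_natCast (by positivity)]
  congr 1
  push_cast
  ring

theorem memLp_comp_neg (G : Lp ℂ 2 (volume : Measure ℝ)) :
    MemLp (fun ξ : ℝ => G (-ξ)) 2 :=
  (Lp.memLp G).comp_measurePreserving (Measure.measurePreserving_neg volume)

theorem aestronglyMeasurable_symbol (s : ℝ) (F : Lp ℂ 2 (volume : Measure ℝ)) :
    AEStronglyMeasurable (symbol s F) volume :=
  (Complex.continuous_ofReal.comp (continuous_bracket_rpow _)).aestronglyMeasurable.mul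
    (memLp_comp_neg _).1

/-- Splits the weighted symbol into an explicit weight and an `L²` function, ready for
Cauchy–Schwarz. -/
theorem bracket_mul_norm_symbol (s r : ℝ) (F : Lp ℂ 2 (volume : Measure ℝ)) (ξ : ℝ) :
    (1 + ξ ^ 2) ^ (r / 2) * ‖symbol s F ξ‖ =
      (1 + ξ ^ 2) ^ (-(s - r) / 2) * ‖(𝓕 F : Lp ℂ 2 (volume : Measure ℝ)) (-ξ)‖ := by
  have h : (0 : ℝ) < 1 + ξ ^ 2 := by positivity
  rw [symbol, norm_mul, Complex.norm_real, norm_eq_abs, abs_of_pos (rpow_pos_of_pos h _),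
    ← mul_assoc, ← rpow_add h]
  congr 2
  ring

theorem integrable_bracket_mul_norm_symbol {s r : ℝ} (h : r + 1 / 2 < s)
    (F : Lp ℂ 2 (volume : Measure ℝ)) :
    Integrable fun ξ : ℝ => (1 + ξ ^ 2) ^ (r / 2) * ‖symbol s F ξ‖ := by
  simp_rw [bracket_mul_norm_symbol]
  exact (memLp_bracket_rpow (by linarith)).integrable_mul (memLp_comp_neg _).norm

theorem integral_norm_sq_comp_neg (G : Lp ℂ 2 (volume : Measure ℝ)) :
    ∫ ξ : ℝ, ‖G (-ξ)‖ ^ 2 = ‖G‖ ^ 2 := by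
  rw [integral_neg_eq_self (fun ξ => ‖G ξ‖ ^ 2) volume]
  have h := L2.inner_def (𝕜 := ℂ) G G
  rw [inner_self_eq_norm_sq_to_K] at h
  simp_rw [inner_self_eq_norm_sq_to_K] at h
  have h2 : ((‖G‖ ^ 2 : ℝ) : ℂ) = ((∫ ξ : ℝ, ‖G ξ‖ ^ 2 : ℝ) : ℂ) := by
    rw [← integral_complex_ofReal]
    push_cast
    exact h
  exact_mod_cast h2.symm

/-- Sobolev embedding on the Fourier side. -/
theorem exists_integral_bracket_mul_norm_symbol_le {s r : ℝ} (h : r + 1 / 2 < s) :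
    ∃ C, 0 ≤ C ∧ ∀ F : Lp ℂ 2 (volume : Measure ℝ),
      ∫ ξ : ℝ, (1 + ξ ^ 2) ^ (r / 2) * ‖symbol s F ξ‖ ≤ C * ‖F‖ := by
  refine ⟨(∫ ξ : ℝ, ((1 + ξ ^ 2) ^ (-(s - r) / 2)) ^ (2 : ℝ)) ^ (1 / 2 : ℝ), by positivity,
    fun F => ?_⟩
  simp_rw [bracket_mul_norm_symbol]
  refine (integral_mul_le_Lp_mul_Lq_of_nonneg (p := 2) (q := 2)
    ⟨by norm_num, by norm_num, by norm_num⟩ (Filter.Eventually.of_forall fun ξ => by positivity)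
    (Filter.Eventually.of_forall fun ξ => by positivity) ?_ ?_).trans ?_
  · simpa using memLp_bracket_rpow (r := s - r) (by linarith)
  · simpa using (memLp_comp_neg _).norm
  · gcongr
    simp_rw [rpow_two]
    rw [integral_norm_sq_comp_neg, ← sqrt_eq_rpow, sqrt_sq (norm_nonneg _), Lp.norm_fourier_eq]

theorem integrable_symbol {s : ℝ} (h : 1 / 2 < s) (F : Lp ℂ 2 (volume : Measure ℝ)) :
    Integrable (symbol s F) := by
  have := integrable_bracket_mul_norm_symbol (s := s) (r := 0) (by linarith) F
  simp only [zero_div, rpow_zero, one_mul] at this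
  exact (integrable_norm_iff (aestronglyMeasurable_symbol s F)).1 this

theorem norm_fourier_le (g : ℝ → ℂ) (x : ℝ) : ‖𝓕 g x‖ ≤ ∫ ξ, ‖g ξ‖ :=
  VectorFourier.norm_fourierIntegral_le_integral_norm _ _ _ _ _

theorem continuous_fourier {g : ℝ → ℂ} (hg : Integrable g) : Continuous (𝓕 g) :=
  VectorFourier.fourierIntegral_continuous Real.continuous_fourierChar (by fun_prop) hg

/-- A function of `H^s`, `s > 1/2`, is recovered from its lift by Fourier inversion. -/
theorem BesselLift.eq_fourier {s : ℝ} (hs : 1 / 2 < s) {f : ℝ → ℝ} (hf : Continuous f)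
    {F : Lp ℂ 2 (volume : Measure ℝ)} (h : BesselLift s f F) (x : ℝ) :
    (f x : ℂ) = 𝓕 (symbol s F) x := by
  obtain ⟨hfL, hF⟩ := h
  have hintg := integrable_symbol hs F
  -- Membership in `H^s` is an identity of distributions, so equality is tested on smooth functions,
  -- holds almost everywhere, and then everywhere by continuity of both sides.
  suffices hae : (fun x => (f x : ℂ)) =ᵐ[volume] 𝓕 (symbol s F) from
    congrFun ((Complex.continuous_ofReal.comp hf).ae_eq_iff_eq volume
      (continuous_fourier hintg) |>.1 hae) x
  refine ae_eq_of_integral_contDiff_smul_eq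
    (Complex.continuous_ofReal.comp hf).locallyIntegrable
    (continuous_fourier hintg).locallyIntegrable fun φ hφ hφc => ?_
  have hφ₁ : HasCompactSupport (Complex.ofRealCLM ∘ φ) := hφc.comp_left rfl
  have hφ₂ : ContDiff ℝ ∞ (Complex.ofRealCLM ∘ φ) := by fun_prop
  set Φ : 𝓢(ℝ, ℂ) := hφ₁.toSchwartzMap hφ₂ with hΦ
  have hΦx : ∀ x, Φ x = (φ x : ℂ) := fun x => rfl
  rw [← besselPotential_neg_apply_eq_iff] at hF
  have h1 : ∫ x, φ x • (f x : ℂ) = (hfL.toLp : 𝓢'(ℝ, ℂ)) Φ := by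
    rw [Lp.toTemperedDistribution_apply]
    refine integral_congr_ae ?_
    filter_upwards [hfL.coeFn_toLp] with x hx
    rw [hx, hΦx, Complex.real_smul, smul_eq_mul]
  have h2 : (hfL.toLp : 𝓢'(ℝ, ℂ)) Φ
      = ∫ ξ, 𝓕⁻ Φ ξ * ((((1 + ξ ^ 2) ^ (-s / 2) : ℝ) : ℂ)
          * (𝓕 F : Lp ℂ 2 (volume : Measure ℝ)) ξ) := by
    rw [← hF, besselPotential, fourierMultiplierCLM_apply, TemperedDistribution.fourierInv_apply,
      smulLeftCLM_apply_apply, Lp.fourier_toTemperedDistribution_eq,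
      Lp.toTemperedDistribution_apply]
    refine integral_congr_ae (Filter.Eventually.of_forall fun ξ => ?_)
    simp only
    rw [SchwartzMap.smulLeftCLM_apply_apply (by fun_prop)]
    simp only [norm_eq_abs, sq_abs, smul_eq_mul]
    ring
  -- Reflecting `ξ` turns `𝓕⁻ Φ` into `𝓕 Φ`, so self-adjointness of `𝓕` can move the transform onto
  -- the symbol.
  rw [h1, h2, ← integral_neg_eq_self]
  have h3 : ∀ ξ : ℝ, 𝓕⁻ Φ (-ξ) = 𝓕 (Φ : ℝ → ℂ) ξ := by
    intro ξ
    rw [SchwartzMap.fourierInv_coe, fourierInv_eq_fourier_neg, neg_neg]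
  have h4 := VectorFourier.integral_fourierIntegral_smul_eq_flip (μ := volume) (ν := volume)
    (L := innerₗ ℝ) (f := (Φ : ℝ → ℂ)) (g := symbol s F) Real.continuous_fourierChar
    (by fun_prop) Φ.integrable hintg
  rw [flip_innerₗ] at h4
  calc _ = ∫ ξ, 𝓕 (Φ : ℝ → ℂ) ξ • symbol s F ξ := by
        refine integral_congr_ae (Filter.Eventually.of_forall fun ξ => ?_)
        simp only [h3, symbol, neg_sq, smul_eq_mul]
    _ = ∫ x, Φ x • 𝓕 (symbol s F) x := h4
    _ = _ := by
        refine integral_congr_ae (Filter.Eventually.of_forall fun ξ => ?_)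
        simp only [hΦx, Complex.real_smul, smul_eq_mul]

/-- Interpolates between the Lipschitz bound, used when `|a - b| ≤ 1`, and the trivial bound `2`. -/
theorem norm_exp_sub_exp_le {α : ℝ} (hα : 0 ≤ α) (hα' : α ≤ 1) (a b : ℝ) :
    ‖Complex.exp (a * Complex.I) - Complex.exp (b * Complex.I)‖ ≤ 2 * |a - b| ^ α := by
  have h1 : Complex.exp (a * Complex.I) - Complex.exp (b * Complex.I)
      = Complex.exp (b * Complex.I) * (Complex.exp (Complex.I * ((a - b : ℝ) : ℂ)) - 1) := by
    rw [mul_sub, mul_one, ← Complex.exp_add]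
    congr 2
    push_cast
    ring
  rw [h1, norm_mul, Complex.norm_exp_ofReal_mul_I, one_mul]
  rcases le_total |a - b| 1 with h | h
  · have h2 := Real.norm_exp_I_mul_ofReal_sub_one_le (x := a - b)
    rw [norm_eq_abs] at h2
    have h3 : |a - b| ^ (1 : ℝ) ≤ |a - b| ^ α :=
      rpow_le_rpow_of_exponent_ge' (abs_nonneg _) h hα hα'
    rw [rpow_one] at h3
    have h4 : 0 ≤ |a - b| ^ α := by positivity
    linarith
  · have h2 : ‖Complex.exp (Complex.I * ((a - b : ℝ) : ℂ)) - 1‖ ≤ 2 := by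
      refine (norm_sub_le _ _).trans ?_
      rw [mul_comm, Complex.norm_exp_ofReal_mul_I, norm_one]
      norm_num
    have h3 : 1 ≤ |a - b| ^ α := one_le_rpow h hα
    linarith

/-- `C²` bounds with a Hölder bound on the second derivative. -/
structure HolderC2Bound (f : ℝ → ℝ) (A α : ℝ) : Prop where
  differentiable : Differentiable ℝ f
  differentiable_deriv : Differentiable ℝ (deriv f)
  abs_le : ∀ x, |f x| ≤ A
  abs_deriv_le : ∀ x, |deriv f x| ≤ A
  abs_deriv_deriv_le : ∀ x, |deriv (deriv f) x| ≤ A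
  holder : ∀ x y, |deriv (deriv f) x - deriv (deriv f) y| ≤ A * |x - y| ^ α

theorem abs_pow_le_bracket {r : ℝ} {k : ℕ} (hk : (k : ℝ) ≤ r) (ξ : ℝ) :
    |ξ| ^ k ≤ (1 + ξ ^ 2) ^ (r / 2) := by
  have h1 : (1 : ℝ) ≤ 1 + ξ ^ 2 := by nlinarith [sq_nonneg ξ]
  calc |ξ| ^ k = (|ξ| ^ 2) ^ ((k : ℝ) / 2) := by
        rw [← rpow_natCast |ξ| 2, ← rpow_mul (abs_nonneg _), ← rpow_natCast]
        congr 1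
        push_cast
        ring
    _ ≤ (1 + ξ ^ 2) ^ ((k : ℝ) / 2) := by
        rw [sq_abs]
        exact rpow_le_rpow (sq_nonneg _) (by linarith) (by positivity)
    _ ≤ _ := rpow_le_rpow_of_exponent_le h1 (by linarith)

theorem abs_rpow_le_bracket {r : ℝ} (hr : 0 ≤ r) (ξ : ℝ) :
    |ξ| ^ r ≤ (1 + ξ ^ 2) ^ (r / 2) := by
  calc |ξ| ^ r = (|ξ| ^ 2) ^ (r / 2) := by
        rw [← rpow_natCast |ξ| 2, ← rpow_mul (abs_nonneg _)]
        congr 1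
        push_cast
        ring
    _ ≤ _ := by
        rw [sq_abs]
        exact rpow_le_rpow (sq_nonneg _) (by linarith) (by positivity)

section FourierBounds

variable {g : ℝ → ℂ} {α : ℝ}

theorem integrable_symbolPow (hgm : AEStronglyMeasurable g volume) {r : ℝ} {k : ℕ}
    (hk : (k : ℝ) ≤ r)
    (hg : Integrable fun ξ : ℝ => (1 + ξ ^ 2) ^ (r / 2) * ‖g ξ‖) (c : ℂ) :
    Integrable (fun ξ : ℝ => (c * ξ) ^ k * g ξ) ∧
      ∫ ξ, ‖(c * ξ) ^ k * g ξ‖ ≤ ‖c‖ ^ k * ∫ ξ : ℝ, (1 + ξ ^ 2) ^ (r / 2) * ‖g ξ‖ := by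
  have hb : ∀ ξ : ℝ, ‖(c * ξ) ^ k * g ξ‖ ≤ ‖c‖ ^ k * ((1 + ξ ^ 2) ^ (r / 2) * ‖g ξ‖) := by
    intro ξ
    rw [norm_mul, norm_pow, norm_mul, Complex.norm_real, norm_eq_abs, mul_pow, mul_assoc]
    gcongr
    exact abs_pow_le_bracket hk ξ
  have hi : Integrable (fun ξ : ℝ => (c * ξ) ^ k * g ξ) :=
    (hg.const_mul (‖c‖ ^ k)).mono'
      ((by fun_prop : Continuous fun ξ : ℝ => (c * (ξ : ℂ)) ^ k).aestronglyMeasurable.mul hgm)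
      (Eventually.of_forall hb)
  refine ⟨hi, ?_⟩
  rw [← integral_const_mul]
  exact integral_mono hi.norm (hg.const_mul _) hb

/-- Each derivative brings down a factor `-2πiξ`. The weight of order `2 + α` pays for two of them
and leaves `|ξ|^α`, which controls the oscillation of the second derivative. -/
theorem holderC2Bound_of_fourier (hgm : AEStronglyMeasurable g volume) (hα : 0 < α) (hα' : α ≤ 1)
    (hg : Integrable fun ξ : ℝ => (1 + ξ ^ 2) ^ ((2 + α) / 2) * ‖g ξ‖) {f : ℝ → ℝ}
    (hf : ∀ x, (f x : ℂ) = 𝓕 g x) :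
    HolderC2Bound f (16 * π ^ 3 * ∫ ξ : ℝ, (1 + ξ ^ 2) ^ ((2 + α) / 2) * ‖g ξ‖) α := by
  set A := ∫ ξ : ℝ, (1 + ξ ^ 2) ^ ((2 + α) / 2) * ‖g ξ‖ with hA
  have hA0 : 0 ≤ A := integral_nonneg fun ξ => by positivity
  set c : ℂ := -2 * π * Complex.I with hc
  have hcn : ‖c‖ = 2 * π := by simp [hc, abs_of_pos pi_pos]
  set G : ℕ → ℝ → ℂ := fun k ξ => (c * ξ) ^ k * g ξ with hG
  have hπ : 3 < π := pi_gt_three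
  have hGi : ∀ k : ℕ, k ≤ 2 → Integrable (G k) ∧ ∫ ξ, ‖G k ξ‖ ≤ (2 * π) ^ k * A := by
    intro k hk
    have hk' : (k : ℝ) ≤ 2 + α := by
      have : (k : ℝ) ≤ 2 := by exact_mod_cast hk
      linarith
    have := integrable_symbolPow hgm hk' hg c
    rwa [hcn] at this
  have hder : ∀ k : ℕ, k ≤ 1 → ∀ x, HasDerivAt (𝓕 (G k)) (𝓕 (G (k + 1)) x) x := by
    intro k hk x
    have hGs : (fun ξ : ℝ => (-2 * π * Complex.I * ξ) • G k ξ) = G (k + 1) := by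
      funext ξ
      simp only [hG, smul_eq_mul, pow_succ]
      ring
    have hi : Integrable fun ξ : ℝ => ξ • G k ξ := by
      have h2 := (hGi (k + 1) (by omega)).1.const_mul c⁻¹
      refine h2.congr (Eventually.of_forall fun ξ => ?_)
      have hc0 : c ≠ 0 := by
        rw [← norm_pos_iff, hcn]
        positivity
      simp only [hG, pow_succ, Complex.real_smul]
      field_simp
    rw [← hGs]
    exact Real.hasDerivAt_fourier (hGi k (by omega)).1 hi x
  have hG0 : G 0 = g := by
    funext ξ
    simp [hG]
  have hf0 : f = fun x => (𝓕 (G 0) x).re := by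
    funext x
    rw [hG0, ← hf, Complex.ofReal_re]
  have hre : ∀ k : ℕ, k ≤ 1 → ∀ x,
      HasDerivAt (fun x => (𝓕 (G k) x).re) (𝓕 (G (k + 1)) x).re x := fun k hk x =>
    (Complex.reCLM.hasFDerivAt.comp_hasDerivAt x (hder k hk x))
  have hf1 : deriv f = fun x => (𝓕 (G 1) x).re := by
    funext x
    rw [hf0]
    exact (hre 0 (by omega) x).deriv
  have hf2 : deriv (deriv f) = fun x => (𝓕 (G 2) x).re := by
    funext x
    rw [hf1]
    exact (hre 1 le_rfl x).deriv
  have hbd : ∀ k : ℕ, k ≤ 2 → ∀ x, |(𝓕 (G k) x).re| ≤ 16 * π ^ 3 * A := by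
    intro k hk x
    refine (Complex.abs_re_le_norm _).trans ((norm_fourier_le _ _).trans ((hGi k hk).2.trans ?_))
    gcongr
    calc (2 * π) ^ k ≤ (2 * π) ^ 2 := pow_le_pow_right₀ (by linarith) hk
      _ ≤ 16 * π ^ 3 := by nlinarith [sq_nonneg π]
  refine ⟨?_, ?_, ?_, ?_, ?_, ?_⟩
  · rw [hf0]
    exact fun x => (hre 0 (by omega) x).differentiableAt
  · rw [hf1]
    exact fun x => (hre 1 le_rfl x).differentiableAt
  · rw [hf0]
    exact hbd 0 (by omega)
  · rw [hf1]
    exact hbd 1 (by omega)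
  · rw [hf2]
    exact hbd 2 le_rfl
  · intro x y
    rw [hf2]
    simp only
    rw [← Complex.sub_re]
    refine (Complex.abs_re_le_norm _).trans ?_
    have hintg : ∀ x : ℝ, Integrable fun ξ : ℝ =>
        Complex.exp (↑(-2 * π * ξ * x) * Complex.I) • G 2 ξ := by
      intro x
      refine (hGi 2 le_rfl).1.norm.mono' ?_ (Eventually.of_forall fun ξ => ?_)
      · exact (by fun_prop : Continuous fun ξ : ℝ =>
          Complex.exp (↑(-2 * π * ξ * x) * Complex.I)).aestronglyMeasurable.smul
            (hGi 2 le_rfl).1.aestronglyMeasurable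
      · rw [norm_smul, Complex.norm_exp_ofReal_mul_I, one_mul]
    rw [Real.fourier_real_eq_integral_exp_smul, Real.fourier_real_eq_integral_exp_smul,
      ← integral_sub (hintg x) (hintg y)]
    calc _ ≤ ∫ ξ : ℝ, 16 * π ^ 3 * |x - y| ^ α * ((1 + ξ ^ 2) ^ ((2 + α) / 2) * ‖g ξ‖) := by
          refine norm_integral_le_of_norm_le (hg.const_mul _) (Eventually.of_forall fun ξ => ?_)
          rw [← sub_smul, norm_smul]
          have h1 := norm_exp_sub_exp_le hα.le hα' (-2 * π * ξ * x) (-2 * π * ξ * y)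
          have h2 : |-2 * π * ξ * x - -2 * π * ξ * y| = 2 * π * (|ξ| * |x - y|) := by
            rw [← mul_sub, abs_mul, abs_mul, abs_mul, abs_neg, abs_two, abs_of_pos pi_pos]
            ring
          have h3 : (2 * π * (|ξ| * |x - y|)) ^ α ≤ 2 * π * (|ξ| ^ α * |x - y| ^ α) := by
            have h6 : (2 * π) ^ α ≤ 2 * π :=
              (rpow_le_rpow_of_exponent_le (by linarith) hα').trans_eq (rpow_one _)
            rw [mul_rpow (x := 2 * π) (by positivity) (by positivity),
              mul_rpow (abs_nonneg _) (abs_nonneg _)]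
            exact mul_le_mul_of_nonneg_right h6 (by positivity)
          rw [h2] at h1
          have h4 : ‖G 2 ξ‖ = (2 * π) ^ 2 * (|ξ| ^ 2 * ‖g ξ‖) := by
            simp only [hG]
            rw [norm_mul, norm_pow, norm_mul, hcn, Complex.norm_real, norm_eq_abs, mul_pow]
            ring
          have h5 : |ξ| ^ α * |ξ| ^ 2 ≤ (1 + ξ ^ 2) ^ ((2 + α) / 2) := by
            refine le_trans (le_of_eq ?_) (abs_rpow_le_bracket (by linarith) ξ)
            rw [add_comm, rpow_add_of_nonneg (abs_nonneg _) hα.le (by norm_num), rpow_two]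
          rw [h4]
          -- The constant is `16π³ = 2 · 2π · (2π)²`: interpolation, `(2π)^α ≤ 2π`, and two
          -- derivatives.
          calc _ ≤ 2 * (2 * π * (|ξ| ^ α * |x - y| ^ α)) * ((2 * π) ^ 2 * (|ξ| ^ 2 * ‖g ξ‖)) := by
                gcongr
                exact h1.trans (by linarith)
            _ = 16 * π ^ 3 * |x - y| ^ α * ((|ξ| ^ α * |ξ| ^ 2) * ‖g ξ‖) := by ring
            _ ≤ _ := by gcongr
      _ = _ := by
          rw [integral_const_mul]
          ring

end FourierBounds

/-- Sobolev embedding `H^s ⊂ C^{2,α}` for `s > 5/2`, with the norm of `H^s` read off from the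
lift. -/
theorem exists_holderC2Bound {s : ℝ} (hs : 5 / 2 < s) :
    ∃ C α : ℝ, 0 ≤ C ∧ 0 < α ∧ ∀ (f : ℝ → ℝ) (F : Lp ℂ 2 (volume : Measure ℝ)), Continuous f →
      BesselLift s f F → ∃ A ≤ C * ‖F‖, HolderC2Bound f A α := by
  -- Half of the excess regularity keeps `2 + α + 1/2 < s` strict; the cap at `1` is required by the
  -- interpolation.
  set α : ℝ := min ((s - 5 / 2) / 2) 1 with hα
  have hα0 : 0 < α := lt_min (by linarith) one_pos
  have hα1 : α ≤ 1 := min_le_right _ _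
  have hαs : 2 + α + 1 / 2 < s := by
    have : α ≤ (s - 5 / 2) / 2 := min_le_left _ _
    linarith
  obtain ⟨C, hC, hCF⟩ := exists_integral_bracket_mul_norm_symbol_le hαs
  refine ⟨16 * π ^ 3 * C, α, by positivity, hα0, fun f F hf h => ⟨_, ?_,
    holderC2Bound_of_fourier (aestronglyMeasurable_symbol s F) hα0 hα1
      (integrable_bracket_mul_norm_symbol hαs F) (h.eq_fourier (by linarith) hf)⟩⟩
  rw [mul_assoc _ C]
  gcongr
  exact hCF F

/-- The Riemann–Lebesgue lemma, as the symbol is integrable. -/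
theorem BesselLift.tendsto_cocompact {s : ℝ} (hs : 1 / 2 < s) {f : ℝ → ℝ} (hf : Continuous f)
    {F : Lp ℂ 2 (volume : Measure ℝ)} (h : BesselLift s f F) :
    Tendsto f (cocompact ℝ) (𝓝 0) := by
  have h1 := (Complex.continuous_re.tendsto 0).comp (Real.zero_at_infty_fourier (symbol s F))
  refine h1.congr fun x => ?_
  simp [← h.eq_fourier hs hf]

/-! ### Time derivatives through bounded functionals of the lift. -/

theorem symbol_add (s : ℝ) (F G : Lp ℂ 2 (volume : Measure ℝ)) :
    symbol s (F + G) =ᵐ[volume] symbol s F + symbol s G := by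
  have h : (fun ξ : ℝ => (𝓕 F + 𝓕 G : Lp ℂ 2 (volume : Measure ℝ)) (-ξ)) =ᵐ[volume]
      fun ξ => (𝓕 F : Lp ℂ 2 (volume : Measure ℝ)) (-ξ)
        + (𝓕 G : Lp ℂ 2 (volume : Measure ℝ)) (-ξ) :=
    (Measure.measurePreserving_neg volume).quasiMeasurePreserving.ae_eq_comp (Lp.coeFn_add _ _)
  filter_upwards [h] with ξ hξ
  rw [Pi.add_apply, symbol, symbol, symbol, FourierTransform.fourier_add, hξ, mul_add]

theorem symbol_smul (s c : ℝ) (F : Lp ℂ 2 (volume : Measure ℝ)) :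
    symbol s (c • F) =ᵐ[volume] (c : ℂ) • symbol s F := by
  have hc : c • F = (c : ℂ) • F := (Complex.coe_smul c F).symm
  have h : (fun ξ : ℝ => ((c : ℂ) • 𝓕 F : Lp ℂ 2 (volume : Measure ℝ)) (-ξ)) =ᵐ[volume]
      fun ξ => (c : ℂ) • (𝓕 F : Lp ℂ 2 (volume : Measure ℝ)) (-ξ) :=
    (Measure.measurePreserving_neg volume).quasiMeasurePreserving.ae_eq_comp (Lp.coeFn_smul _ _)
  filter_upwards [h] with ξ hξ
  rw [Pi.smul_apply, symbol, symbol, hc, FourierTransform.fourier_smul, hξ, smul_eq_mul,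
    smul_eq_mul]
  ring

/-- The real part of the function of `H^s` with lift `F`. -/
def lowered (s : ℝ) (F : Lp ℂ 2 (volume : Measure ℝ)) (y : ℝ) : ℝ := (𝓕 (symbol s F) y).re

theorem BesselLift.eq_lowered {s : ℝ} (hs : 1 / 2 < s) {f : ℝ → ℝ} (hf : Continuous f)
    {F : Lp ℂ 2 (volume : Measure ℝ)} (h : BesselLift s f F) : f = lowered s F := by
  funext y
  rw [lowered, ← h.eq_fourier hs hf, Complex.ofReal_re]

section Lowered

variable {s : ℝ}

theorem continuous_lowered (hs : 1 / 2 < s) (F : Lp ℂ 2 (volume : Measure ℝ)) :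
    Continuous (lowered s F) :=
  Complex.continuous_re.comp (continuous_fourier (integrable_symbol hs F))

theorem lowered_add (hs : 1 / 2 < s) (F G : Lp ℂ 2 (volume : Measure ℝ)) (y : ℝ) :
    lowered s (F + G) y = lowered s F y + lowered s G y := by
  have h := VectorFourier.fourierIntegral_add (μ := volume) (L := innerₗ ℝ)
    Real.continuous_fourierChar (by fun_prop) (integrable_symbol hs F) (integrable_symbol hs G)
  rw [lowered, Real.fourier_congr_ae (symbol_add s F G) y, lowered, lowered, ← Complex.add_re]
  exact congrArg Complex.re (congrFun h y)

theorem exists_abs_lowered_le (hs : 1 / 2 < s) :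
    ∃ C, 0 ≤ C ∧ ∀ (F : Lp ℂ 2 (volume : Measure ℝ)) (y : ℝ), |lowered s F y| ≤ C * ‖F‖ := by
  obtain ⟨C, hC, h⟩ := exists_integral_bracket_mul_norm_symbol_le (s := s) (r := 0) (by linarith)
  refine ⟨C, hC, fun F y => (Complex.abs_re_le_norm _).trans ((norm_fourier_le _ _).trans ?_)⟩
  simpa using h F

theorem lowered_smul (c : ℝ) (F : Lp ℂ 2 (volume : Measure ℝ)) (y : ℝ) :
    lowered s (c • F) y = c * lowered s F y := by
  have h := VectorFourier.fourierIntegral_const_smul Real.fourierChar volume (innerₗ ℝ)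
    (symbol s F) (c : ℂ)
  rw [lowered, Real.fourier_congr_ae (symbol_smul s c F) y, lowered, ← Complex.re_ofReal_mul]
  exact congrArg Complex.re (congrFun h y)

/-- Evaluation at a point, as a functional of the lift. -/
def evalCLM (hs : 1 / 2 < s) (y : ℝ) : Lp ℂ 2 (volume : Measure ℝ) →L[ℝ] ℝ :=
  LinearMap.mkContinuousOfExistsBound
    { toFun := fun F => lowered s F y
      map_add' := fun F G => lowered_add hs F G y
      map_smul' := fun c F => lowered_smul c F y }
    (let ⟨C, _, h⟩ := exists_abs_lowered_le hs
     ⟨C, fun F => h F y⟩)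

@[simp]
theorem evalCLM_apply (hs : 1 / 2 < s) (y : ℝ) (F : Lp ℂ 2 (volume : Measure ℝ)) :
    evalCLM hs y F = lowered s F y := rfl

theorem integrable_lowered_mul (hs : 1 / 2 < s) {ψ : ℝ → ℝ} (hψ : Continuous ψ)
    (hψc : HasCompactSupport ψ)
    (F : Lp ℂ 2 (volume : Measure ℝ)) : Integrable fun y => lowered s F y * ψ y :=
  ((continuous_lowered hs F).mul hψ).integrable_of_hasCompactSupport hψc.mul_left

/-- Integration against a test function, as a functional of the lift. -/
def pairCLM (hs : 1 / 2 < s) {ψ : ℝ → ℝ} (hψ : Continuous ψ) (hψc : HasCompactSupport ψ) :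
    Lp ℂ 2 (volume : Measure ℝ) →L[ℝ] ℝ :=
  LinearMap.mkContinuousOfExistsBound
    { toFun := fun F => ∫ y, lowered s F y * ψ y
      map_add' := fun F G => by
        rw [← integral_add (integrable_lowered_mul hs hψ hψc F)
          (integrable_lowered_mul hs hψ hψc G)]
        simp_rw [lowered_add hs, add_mul]
      map_smul' := fun c F => by
        simp_rw [lowered_smul, mul_assoc, integral_const_mul]
        rfl }
    (by
      obtain ⟨C, hC, h⟩ := exists_abs_lowered_le hs
      refine ⟨C * ∫ y, ‖ψ y‖, fun F => ?_⟩
      have hi : Integrable ψ := hψ.integrable_of_hasCompactSupport hψc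
      calc ‖∫ y, lowered s F y * ψ y‖ ≤ ∫ y, C * ‖F‖ * ‖ψ y‖ := by
            refine norm_integral_le_of_norm_le (hi.norm.const_mul _)
              (Eventually.of_forall fun y => ?_)
            rw [norm_mul]
            gcongr
            exact h F y
        _ = _ := by
            rw [integral_const_mul]
            ring)

@[simp]
theorem pairCLM_apply (hs : 1 / 2 < s) {ψ : ℝ → ℝ} (hψ : Continuous ψ) (hψc : HasCompactSupport ψ)
    (F : Lp ℂ 2 (volume : Measure ℝ)) :
    pairCLM hs hψ hψc F = ∫ y, lowered s F y * ψ y := rfl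

end Lowered

/-- Evaluation at a point is a bounded linear functional of the lift, so the chain rule turns
differentiability of the `L²` curve into the classical derivative in time. -/
theorem exists_timeDeriv_eq_lowered {T σ : ℝ} (hσ : 1 / 2 < σ) {u : ℝ → ℝ → ℝ}
    (hc : ∀ t ∈ Ico 0 T, Continuous (u t)) (hu : CurveInHs 1 T σ u) :
    ∃ U U' : ℝ → Lp ℂ 2 (volume : Measure ℝ), (∀ t ∈ Ico 0 T, u t = lowered σ (U t)) ∧
      ∀ t ∈ Ico 0 T, HasDerivWithinAt U (U' t) (Ico 0 T) t ∧
        timeDeriv T u t = lowered σ (U' t) := by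
  obtain ⟨U, hU, hUu⟩ := hu
  have heq : ∀ t ∈ Ico 0 T, u t = lowered σ (U t) := fun t ht =>
    (hUu t ht).eq_lowered hσ (hc t ht)
  refine ⟨U, derivWithin U (Ico 0 T), heq, fun t ht => ?_⟩
  have hd : HasDerivWithinAt U (derivWithin U (Ico 0 T) t) (Ico 0 T) t :=
    (hU.differentiableOn (by simp) t ht).hasDerivWithinAt
  refine ⟨hd, funext fun y => ?_⟩
  have h1 := (evalCLM hσ y).hasFDerivAt.comp_hasDerivWithinAt t hd
  have h2 : HasDerivWithinAt (fun τ => u τ y) (lowered σ (derivWithin U (Ico 0 T) t) y)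
      (Ico 0 T) t :=
    h1.congr (fun τ hτ => by simp [heq τ hτ]) (by simp [heq t ht])
  exact h2.derivWithin (uniqueDiffOn_Ico 0 T t ht)

theorem continuous_timeDeriv {T σ : ℝ} (hσ : 1 / 2 < σ) {u : ℝ → ℝ → ℝ}
    (hc : ∀ t ∈ Ico 0 T, Continuous (u t)) (hu : CurveInHs 1 T σ u) {t : ℝ} (ht : t ∈ Ico 0 T) :
    Continuous (timeDeriv T u t) := by
  obtain ⟨U, U', -, h⟩ := exists_timeDeriv_eq_lowered hσ hc hu
  rw [(h t ht).2]
  exact continuous_lowered hσ _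

/-- Pairing with `ψ` is a bounded linear functional of the lift, so the chain rule replaces
differentiation under the integral. -/
theorem hasDerivWithinAt_integral_mul {T σ : ℝ} (hσ : 1 / 2 < σ) {u : ℝ → ℝ → ℝ}
    (hc : ∀ t ∈ Ico 0 T, Continuous (u t)) (hu : CurveInHs 1 T σ u) {ψ : ℝ → ℝ}
    (hψ : Continuous ψ) (hψc : HasCompactSupport ψ) {t : ℝ} (ht : t ∈ Ico 0 T) :
    HasDerivWithinAt (fun τ => ∫ y, u τ y * ψ y) (∫ y, timeDeriv T u t y * ψ y) (Ico 0 T) t := by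
  obtain ⟨U, U', heq, h⟩ := exists_timeDeriv_eq_lowered hσ hc hu
  have h1 := (pairCLM hσ hψ hψc).hasFDerivAt.comp_hasDerivWithinAt t (h t ht).1
  rw [pairCLM_apply, ← (h t ht).2] at h1
  exact h1.congr (fun τ hτ => by simp [heq τ hτ]) (by simp [heq t ht])

/-! ### Minimum principle for the transport inequality. -/

/-- A minimum principle for the transport inequality `|w_t + b w_x| ≤ K (|w| + δ)` on a strip. -/
theorem neg_mul_exp_le_of_transport {w w' v b : ℝ → ℝ → ℝ} {τ K δ B W : ℝ} (hK : 0 ≤ K) (hδ : 0 ≤ δ)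
    (hw : ContinuousOn (fun p : ℝ × ℝ => w p.1 p.2) (Icc 0 τ ×ˢ univ))
    (ht : ∀ t ∈ Icc 0 τ, ∀ x, HasDerivWithinAt (fun r => w r x) (w' t x) (Icc 0 τ) t)
    (hx : ∀ t ∈ Icc 0 τ, ∀ x, HasDerivAt (w t) (v t x) x)
    (hb : ∀ t ∈ Icc 0 τ, ∀ x, |b t x| ≤ B) (hW : ∀ t ∈ Icc 0 τ, ∀ x, |w t x| ≤ W)
    (h : ∀ t ∈ Icc 0 τ, ∀ x, |w' t x + b t x * v t x| ≤ K * (|w t x| + δ))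
    (h0 : ∀ x, 0 ≤ w 0 x) {t : ℝ} (htτ : t ∈ Icc 0 τ) (x : ℝ) :
    -(δ * exp (2 * K * t)) ≤ w t x := by
  have hB : 0 ≤ B := (abs_nonneg _).trans (hb t htτ 0)
  have hW0 : 0 ≤ W := (abs_nonneg _).trans (hW t htτ 0)
  -- The term `η √(1 + x²)` forces a negative infimum to be attained. Its slope is at most `η`, so
  -- the drift costs at most `η B`, and `η (B + 1) t` overcompensates. The rate `2K`, rather than
  -- `K`, absorbs `δ`, since `δ < -w` at a negative minimum.
  have key : ∀ η > 0,
      0 ≤ exp (-(2 * K * t)) * w t x + δ + η * (√(1 + x ^ 2) + (B + 1) * t) := by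
    intro η hη
    set z : ℝ × ℝ → ℝ := fun p =>
      exp (-(2 * K * p.1)) * w p.1 p.2 + δ + η * (√(1 + p.2 ^ 2) + (B + 1) * p.1) with hz
    by_contra! hneg
    have hzneg : z (t, x) < 0 := hneg
    -- For `|y| > R` the penalty is at least `W`, so `z ≥ 0` there and a negative minimum over the
    -- box is global.
    set R : ℝ := max |x| (W / η) with hR
    have hzc : ContinuousOn z (Icc 0 τ ×ˢ Icc (-R) R) := by
      have h1 := hw.mono (prod_mono_right (subset_univ (Icc (-R) R)) : Icc 0 τ ×ˢ Icc (-R) R ⊆ _)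
      have h2 : Continuous fun p : ℝ × ℝ => exp (-(2 * K * p.1)) := by fun_prop
      have h3 : Continuous fun p : ℝ × ℝ => η * (√(1 + p.2 ^ 2) + (B + 1) * p.1) := by fun_prop
      exact ((h2.continuousOn.mul h1).add continuousOn_const).add h3.continuousOn
    have hmem : (t, x) ∈ Icc 0 τ ×ˢ Icc (-R) R :=
      ⟨htτ, abs_le.1 (le_max_left _ _)⟩
    obtain ⟨⟨t₀, x₀⟩, ⟨ht₀, -⟩, hmin⟩ :=
      (isCompact_Icc.prod isCompact_Icc).exists_isMinOn ⟨_, hmem⟩ hzc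
    simp only at ht₀
    have hz₀ : z (t₀, x₀) < 0 := (hmin hmem).trans_lt hzneg
    have hglob : ∀ r ∈ Icc 0 τ, ∀ y, z (t₀, x₀) ≤ z (r, y) := by
      intro r hr y
      by_cases hy : y ∈ Icc (-R) R
      · exact hmin (show (r, y) ∈ _ from ⟨hr, hy⟩)
      · refine hz₀.le.trans ?_
        have hyR : R < |y| := by
          by_contra! hle
          exact hy (abs_le.1 hle)
        have h1 : W ≤ η * |y| := by
          have : W / η ≤ |y| := (le_max_right _ _).trans hyR.le
          rw [div_le_iff₀ hη] at this
          linarith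
        have h2 : |y| ≤ √(1 + y ^ 2) := abs_le_sqrt (by linarith)
        have h3 : exp (-(2 * K * r)) ≤ 1 := exp_le_one_iff.2 (by nlinarith [hr.1])
        have h4 : -W ≤ exp (-(2 * K * r)) * w r y := by
          have h5 := (abs_le.1 (hW r hr y)).1
          have h6 := exp_pos (-(2 * K * r))
          nlinarith
        have h5 : η * |y| ≤ η * √(1 + y ^ 2) := by gcongr
        have h6 : 0 ≤ η * ((B + 1) * r) := by
          have := hr.1
          positivity
        simp only [hz]
        linarith
    have ht₀pos : 0 < t₀ := by
      refine lt_of_le_of_ne ht₀.1 fun h' => ?_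
      have h1 := h0 x₀
      have h2 : 0 ≤ z (t₀, x₀) := by
        simp only [hz, ← h']
        simp only [mul_zero, neg_zero, exp_zero, one_mul, add_zero]
        positivity
      linarith
    have hzx : HasDerivAt (fun y => z (t₀, y))
        (exp (-(2 * K * t₀)) * v t₀ x₀ + η * (x₀ / √(1 + x₀ ^ 2))) x₀ := by
      have h1 : HasDerivAt (fun y : ℝ => √(1 + y ^ 2)) (x₀ / √(1 + x₀ ^ 2)) x₀ := by
        have h2 : HasDerivAt (fun y : ℝ => 1 + y ^ 2) (2 * x₀) x₀ := by
          simpa using (hasDerivAt_pow 2 x₀).const_add 1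
        convert! h2.sqrt (by positivity) using 1
        field_simp
      exact (((hx t₀ ht₀ x₀).const_mul (exp (-(2 * K * t₀)))).add_const δ).fun_add
        ((h1.add_const ((B + 1) * t₀)).const_mul η)
    have hzx0 : IsLocalMin (fun y => z (t₀, y)) x₀ := Eventually.of_forall (hglob t₀ ht₀)
    have hzx1 := IsLocalMin.hasDerivAt_eq_zero hzx0 hzx
    have hzt : HasDerivWithinAt (fun r => z (r, x₀))
        (-(2 * K) * exp (-(2 * K * t₀)) * w t₀ x₀ + exp (-(2 * K * t₀)) * w' t₀ x₀
          + η * (B + 1)) (Icc 0 t₀) t₀ := by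
      have h1 : HasDerivAt (fun r : ℝ => exp (-(2 * K * r)))
          (-(2 * K) * exp (-(2 * K * t₀))) t₀ := by
        have h2 : HasDerivAt (fun r : ℝ => -(2 * K * r)) (-(2 * K)) t₀ := by
          simpa using ((hasDerivAt_id t₀).const_mul (2 * K)).fun_neg
        convert! h2.exp using 1
        ring
      have h2 : HasDerivAt (fun r : ℝ => η * (√(1 + x₀ ^ 2) + (B + 1) * r)) (η * (B + 1)) t₀ := by
        simpa using (((hasDerivAt_id t₀).const_mul (B + 1)).const_add (√(1 + x₀ ^ 2))).const_mul η
      have h3 := (ht t₀ ht₀ x₀).mono (Icc_subset_Icc_right ht₀.2)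
      exact ((h1.hasDerivWithinAt.fun_mul h3).add_const δ).fun_add h2.hasDerivWithinAt
    have hzt0 : -(2 * K) * exp (-(2 * K * t₀)) * w t₀ x₀ + exp (-(2 * K * t₀)) * w' t₀ x₀
          + η * (B + 1) ≤ 0 := by
      -- Only left difference quotients are used, because `t₀` may equal `τ`; they give `z_t ≤ 0`.
      have hmono : HasDerivWithinAt (fun r => z (r, x₀)) _ (Iio t₀) t₀ :=
        (hzt.mono_of_mem_nhdsWithin (s := Iio t₀) (by
          exact mem_of_superset (Ioo_mem_nhdsLT ht₀pos) Ioo_subset_Icc_self))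
      rw [hasDerivWithinAt_iff_tendsto_slope' (by simp)] at hmono
      refine le_of_tendsto hmono ?_
      filter_upwards [Ioo_mem_nhdsLT ht₀pos] with r hr
      rw [slope_def_field]
      refine div_nonpos_of_nonneg_of_nonpos ?_ (by linarith [hr.2])
      have := hglob r ⟨hr.1.le, hr.2.le.trans ht₀.2⟩ x₀
      linarith
    have he := exp_pos (-(2 * K * t₀))
    have he1 : exp (-(2 * K * t₀)) ≤ 1 := exp_le_one_iff.2 (by nlinarith)
    have hwneg : exp (-(2 * K * t₀)) * w t₀ x₀ < -δ := by
      have h1 : 0 ≤ η * (√(1 + x₀ ^ 2) + (B + 1) * t₀) := by positivity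
      simp only [hz] at hz₀
      linarith
    have hwδ : δ < -w t₀ x₀ := by
      by_contra! hle
      nlinarith
    have habs : |w t₀ x₀| = -w t₀ x₀ := abs_of_neg (by linarith)
    have htr := (abs_le.1 (h t₀ ht₀ x₀)).1
    rw [habs] at htr
    have hbx : -B ≤ b t₀ x₀ * (x₀ / √(1 + x₀ ^ 2)) := by
      have h1 : |x₀ / √(1 + x₀ ^ 2)| ≤ 1 := by
        rw [abs_div, abs_of_nonneg (sqrt_nonneg _)]
        exact div_le_one_of_le₀ (abs_le_sqrt (by linarith)) (sqrt_nonneg _)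
      have h2 : |b t₀ x₀ * (x₀ / √(1 + x₀ ^ 2))| ≤ B := by
        rw [abs_mul]
        exact (mul_le_mul (hb t₀ ht₀ x₀) h1 (abs_nonneg _) hB).trans_eq (mul_one B)
      exact (abs_le.1 h2).1
    set E := exp (-(2 * K * t₀))
    have h1 : E * (-(K * (-w t₀ x₀ + δ))) ≤ E * (w' t₀ x₀ + b t₀ x₀ * v t₀ x₀) :=
      mul_le_mul_of_nonneg_left htr he.le
    have h2 : 0 ≤ E * (K * (-w t₀ x₀ - δ)) := by
      have : 0 ≤ -w t₀ x₀ - δ := by linarith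
      positivity
    have h3 : E * (b t₀ x₀ * v t₀ x₀) = -(η * (b t₀ x₀ * (x₀ / √(1 + x₀ ^ 2)))) := by
      linear_combination b t₀ x₀ * hzx1
    have h4 : η * -B ≤ η * (b t₀ x₀ * (x₀ / √(1 + x₀ ^ 2))) :=
      mul_le_mul_of_nonneg_left hbx hη.le
    linarith
  have hlim : 0 ≤ exp (-(2 * K * t)) * w t x + δ := by
    have h1 : Tendsto (fun η : ℝ =>
        exp (-(2 * K * t)) * w t x + δ + η * (√(1 + x ^ 2) + (B + 1) * t)) (𝓝[>] 0)
        (𝓝 (exp (-(2 * K * t)) * w t x + δ + 0 * (√(1 + x ^ 2) + (B + 1) * t))) :=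
      (Continuous.tendsto (by fun_prop) 0).mono_left nhdsWithin_le_nhds
    rw [zero_mul, add_zero] at h1
    exact ge_of_tendsto h1 (eventually_mem_nhdsWithin.mono fun η hη => key η hη)
  have hE : exp (2 * K * t) * exp (-(2 * K * t)) = 1 := by rw [← exp_add]; simp
  have h1 : 0 ≤ exp (2 * K * t) * (exp (-(2 * K * t)) * w t x + δ) := by positivity
  have h2 : exp (2 * K * t) * (exp (-(2 * K * t)) * w t x + δ) = w t x + δ * exp (2 * K * t) := by
    linear_combination w t x * hE
  linarith

/-! ### Mollifiers and the commutator estimate. -/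

/-- A smooth nonnegative kernel of mass one, supported in `[-ε, ε]`, whose derivative has
`L¹` norm at most `A / ε`. -/
structure IsMollifier (ρ : ℝ → ℝ) (ε A : ℝ) : Prop where
  contDiff : ContDiff ℝ ∞ ρ
  hasCompactSupport : HasCompactSupport ρ
  nonneg : ∀ x, 0 ≤ ρ x
  integral_eq_one : ∫ x, ρ x = 1
  eq_zero : ∀ x, ε < |x| → ρ x = 0
  deriv_eq_zero : ∀ x, ε < |x| → deriv ρ x = 0
  integral_abs_deriv_le : ∫ x, |deriv ρ x| ≤ A / ε

/-- A fixed unit bump is rescaled; `A` is the `L¹` norm of its derivative, hence independent of `ε`.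
-/
theorem exists_isMollifier : ∃ A : ℝ, 0 ≤ A ∧ ∀ ε > 0, ∃ ρ, IsMollifier ρ ε A := by
  let β : ContDiffBump (0 : ℝ) := ⟨1 / 2, 1, by norm_num, by norm_num⟩
  set η : ℝ → ℝ := β.normed volume with hη
  have hηc : HasCompactSupport η := β.hasCompactSupport_normed
  have hηd : ContDiff ℝ ∞ η := β.contDiff_normed
  have hη0 : ∀ x : ℝ, 1 < |x| → η x = 0 := by
    intro x hx
    have h1 : x ∉ Function.support η := by
      rw [hη, β.support_normed_eq]
      simpa [β] using hx.le
    simpa using h1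
  have hη1 : ∀ x : ℝ, 1 < |x| → deriv η x = 0 := by
    intro x hx
    have h1 : η =ᶠ[𝓝 x] fun _ => 0 := by
      filter_upwards [continuous_abs.continuousAt.eventually (lt_mem_nhds hx)] with y hy
      exact hη0 y hy
    rw [h1.deriv_eq, deriv_const]
  refine ⟨∫ x, |deriv η x|, integral_nonneg fun x => abs_nonneg _, fun ε hε =>
    ⟨fun x => ε⁻¹ * η (ε⁻¹ * x), ?_⟩⟩
  have hε' : 0 < ε⁻¹ := inv_pos.2 hε
  have hder : ∀ x, deriv (fun x => ε⁻¹ * η (ε⁻¹ * x)) x = ε⁻¹ * (ε⁻¹ * deriv η (ε⁻¹ * x)) := by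
    intro x
    rw [deriv_const_mul_field, deriv_comp_mul_left, smul_eq_mul]
  have hlt : ∀ x : ℝ, ε < |x| → 1 < |ε⁻¹ * x| := by
    intro x hx
    rw [abs_mul, abs_of_pos hε', inv_mul_eq_div, lt_div_iff₀ hε, one_mul]
    exact hx
  refine ⟨?_, ?_, ?_, ?_, ?_, ?_, ?_⟩
  · fun_prop
  · exact (hηc.comp_homeomorph (Homeomorph.mulLeft₀ ε⁻¹ hε'.ne')).mul_left
  · exact fun x => mul_nonneg hε'.le (β.nonneg_normed _)
  · rw [integral_const_mul, Measure.integral_comp_mul_left, β.integral_normed, inv_inv,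
      abs_of_pos hε, smul_eq_mul, mul_one, inv_mul_cancel₀ hε.ne']
  · intro x hx
    rw [hη0 _ (hlt x hx), mul_zero]
  · intro x hx
    rw [hder, hη1 _ (hlt x hx), mul_zero, mul_zero]
  · refine le_of_eq ?_
    simp_rw [hder, abs_mul, abs_of_pos hε', integral_const_mul]
    rw [Measure.integral_comp_mul_left (fun x => |deriv η x|), inv_inv, abs_of_pos hε,
      smul_eq_mul]
    field_simp

namespace IsMollifier

variable {ρ : ℝ → ℝ} {ε A : ℝ}

theorem continuous (hρ : IsMollifier ρ ε A) : Continuous ρ := hρ.contDiff.continuous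

theorem continuous_deriv (hρ : IsMollifier ρ ε A) : Continuous (deriv ρ) :=
  hρ.contDiff.continuous_deriv (by simp)

theorem continuous_deriv_deriv (hρ : IsMollifier ρ ε A) : Continuous (deriv (deriv ρ)) :=
  (((contDiff_infty_iff_deriv.1 hρ.contDiff).2).continuous_deriv (by simp))

theorem hasCompactSupport_deriv (hρ : IsMollifier ρ ε A) : HasCompactSupport (deriv ρ) :=
  hρ.hasCompactSupport.deriv

theorem integrable_abs_deriv_sub (hρ : IsMollifier ρ ε A) (x : ℝ) :
    Integrable fun y => |deriv ρ (x - y)| :=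
  ((hρ.continuous_deriv.integrable_of_hasCompactSupport hρ.hasCompactSupport_deriv).comp_sub_left
    x).abs

theorem integrable_sub (hρ : IsMollifier ρ ε A) (x : ℝ) : Integrable fun y => ρ (x - y) :=
  (hρ.continuous.integrable_of_hasCompactSupport hρ.hasCompactSupport).comp_sub_left x

theorem integral_sub (hρ : IsMollifier ρ ε A) (x : ℝ) : ∫ y, ρ (x - y) = 1 := by
  rw [integral_sub_left_eq_self ρ volume x, hρ.integral_eq_one]

theorem integral_abs_deriv_sub_le (hρ : IsMollifier ρ ε A) (x : ℝ) :
    ∫ y, |deriv ρ (x - y)| ≤ A / ε := by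
  rw [integral_sub_left_eq_self (fun y => |deriv ρ y|) volume x]
  exact hρ.integral_abs_deriv_le

theorem hasCompactSupport_comp_sub {g : ℝ → ℝ} (hg : HasCompactSupport g) (x : ℝ) :
    HasCompactSupport fun y => g (x - y) :=
  hg.comp_homeomorph (Homeomorph.subLeft x)

theorem integrable_mul_sub (hρ : IsMollifier ρ ε A) {m : ℝ → ℝ} (hm : Continuous m) (x : ℝ) :
    Integrable fun y => m y * ρ (x - y) :=
  (hm.mul (hρ.continuous.comp (by fun_prop))).integrable_of_hasCompactSupport
    (hasCompactSupport_comp_sub hρ.hasCompactSupport x).mul_left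

theorem integrable_mul_deriv_sub (hρ : IsMollifier ρ ε A) {m : ℝ → ℝ} (hm : Continuous m) (x : ℝ) :
    Integrable fun y => m y * deriv ρ (x - y) :=
  (hm.mul (hρ.continuous_deriv.comp (by fun_prop))).integrable_of_hasCompactSupport
    (hasCompactSupport_comp_sub hρ.hasCompactSupport_deriv x).mul_left

theorem abs_integral_mul_le (hρ : IsMollifier ρ ε A) {m : ℝ → ℝ} {x N : ℝ}
    (hN : ∀ y, |x - y| ≤ ε → |m y| ≤ N) :
    |∫ y, m y * ρ (x - y)| ≤ N := by
  calc |∫ y, m y * ρ (x - y)| ≤ ∫ y, N * ρ (x - y) := by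
        rw [← norm_eq_abs]
        refine norm_integral_le_of_norm_le ((hρ.integrable_sub x).const_mul N)
          (Eventually.of_forall fun y => ?_)
        rw [norm_mul, norm_eq_abs, norm_eq_abs, abs_of_nonneg (hρ.nonneg _)]
        by_cases hy : |x - y| ≤ ε
        · exact mul_le_mul_of_nonneg_right (hN y hy) (hρ.nonneg _)
        · rw [hρ.eq_zero _ (not_le.1 hy), mul_zero, mul_zero]
    _ = N := by rw [integral_const_mul, hρ.integral_sub, mul_one]

theorem abs_integral_sub_le (hρ : IsMollifier ρ ε A) {m : ℝ → ℝ} (hm : Continuous m) {x θ : ℝ}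
    (hθ : ∀ y, |x - y| ≤ ε → |m y - m x| ≤ θ) : |(∫ y, m y * ρ (x - y)) - m x| ≤ θ := by
  have h1 : (∫ y, m y * ρ (x - y)) - m x = ∫ y, (m y - m x) * ρ (x - y) := by
    simp_rw [sub_mul]
    rw [MeasureTheory.integral_sub (hρ.integrable_mul_sub hm x) ((hρ.integrable_sub x).const_mul _),
      integral_const_mul, hρ.integral_sub, mul_one]
  rw [h1]
  exact hρ.abs_integral_mul_le (m := fun y => m y - m x) hθ

/-- The error made by mollifying `∂_x (b m) + c m` is controlled by the mollified function and
the oscillation of `m`. -/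
theorem abs_commutator_le (hρ : IsMollifier ρ ε A) (hε : 0 < ε) {m b c : ℝ → ℝ} (hm : Continuous m)
    {L C θ x : ℝ} (hL : 0 ≤ L) (hC : 0 ≤ C) (hb : ∀ y, |b x - b y| ≤ L * |x - y|)
    (hc : ∀ y, |c y| ≤ C) (hθ : ∀ y, |x - y| ≤ ε → |m y - m x| ≤ θ) :
    |(∫ y, (b x - b y) * m y * deriv ρ (x - y)) - ∫ y, c y * m y * ρ (x - y)|
      ≤ (L * A + C) * (|∫ y, m y * ρ (x - y)| + 2 * θ) := by
  set N := |∫ y, m y * ρ (x - y)| + 2 * θ with hN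
  -- Near `x`, `m y` is within `θ` of `m x`, itself within `θ` of the mollified value; hence `2 *
  -- θ`.
  have hmN : ∀ y, |x - y| ≤ ε → |m y| ≤ N := by
    intro y hy
    have h1 := abs_le.1 (hρ.abs_integral_sub_le hm hθ)
    have h2 := abs_le.1 (hθ y hy)
    have h3 := le_abs_self (∫ y, m y * ρ (x - y))
    have h4 := neg_abs_le (∫ y, m y * ρ (x - y))
    rw [abs_le]
    constructor <;> linarith [h1.1, h1.2, h2.1, h2.2]
  have hN0 : 0 ≤ N := (abs_nonneg _).trans (hmN x (by simpa using hε.le))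
  -- On the support of the kernel the Lipschitz gain `L ε` cancels the `A / ε` of the differentiated
  -- kernel.
  have h1 : |∫ y, (b x - b y) * m y * deriv ρ (x - y)| ≤ L * A * N := by
    calc |∫ y, (b x - b y) * m y * deriv ρ (x - y)|
        ≤ ∫ y, L * ε * N * |deriv ρ (x - y)| := by
          rw [← norm_eq_abs]
          refine norm_integral_le_of_norm_le ((hρ.integrable_abs_deriv_sub x).const_mul _)
            (Eventually.of_forall fun y => ?_)
          rw [norm_mul, norm_mul, norm_eq_abs, norm_eq_abs, norm_eq_abs]
          by_cases hy : |x - y| ≤ ε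
          · have h2 : |b x - b y| ≤ L * ε := (hb y).trans (by gcongr)
            have h3 := hmN y hy
            gcongr
          · rw [hρ.deriv_eq_zero _ (not_le.1 hy), abs_zero, mul_zero, mul_zero]
      _ ≤ L * ε * N * (A / ε) := by
          rw [integral_const_mul]
          have := hρ.integral_abs_deriv_sub_le x
          gcongr
      _ = _ := by field_simp
  have h2 : |∫ y, c y * m y * ρ (x - y)| ≤ C * N := by
    refine hρ.abs_integral_mul_le (m := fun y => c y * m y) fun y hy => ?_
    rw [abs_mul]
    exact mul_le_mul (hc y) (hmN y hy) (abs_nonneg _) hC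
  calc _ ≤ _ := abs_sub _ _
    _ ≤ L * A * N + C * N := add_le_add h1 h2
    _ = _ := by ring

theorem hasDerivAt_integral_mul (hρ : IsMollifier ρ ε A) {m : ℝ → ℝ} (hm : Continuous m) (x : ℝ) :
    HasDerivAt (fun x => ∫ y, m y * ρ (x - y)) (∫ y, m y * deriv ρ (x - y)) x :=
  hρ.hasCompactSupport.hasDerivAt_convolution_right (ContinuousLinearMap.mul ℝ ℝ)
    (μ := volume) hm.locallyIntegrable (hρ.contDiff.of_le (by simp)) x

end IsMollifier

/-! ### Bounds on the momentum and on the transport speed. -/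

namespace HolderC2Bound

variable {f : ℝ → ℝ} {A α : ℝ}

theorem mono (h : HolderC2Bound f A α) {A' : ℝ} (hA : A ≤ A') : HolderC2Bound f A' α where
  differentiable := h.differentiable
  differentiable_deriv := h.differentiable_deriv
  abs_le x := (h.abs_le x).trans hA
  abs_deriv_le x := (h.abs_deriv_le x).trans hA
  abs_deriv_deriv_le x := (h.abs_deriv_deriv_le x).trans hA
  holder x y := (h.holder x y).trans (by gcongr)

theorem nonneg (h : HolderC2Bound f A α) : 0 ≤ A := (abs_nonneg _).trans (h.abs_le 0)

theorem continuous_deriv_deriv (h : HolderC2Bound f A α) (hα : 0 < α) :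
    Continuous (deriv (deriv f)) := by
  refine continuous_iff_continuousAt.2 fun x => tendsto_iff_dist_tendsto_zero.2 ?_
  have h1 : Continuous fun y : ℝ => A * |y - x| ^ α :=
    continuous_const.mul ((by fun_prop : Continuous fun y : ℝ => |y - x|).rpow_const
      fun _ => Or.inr hα.le)
  have h2 : Tendsto (fun y : ℝ => A * |y - x| ^ α) (𝓝 x) (𝓝 0) := by
    have := h1.tendsto x
    simpa [zero_rpow hα.ne'] using this
  exact squeeze_zero (fun y => dist_nonneg) (fun y => by
    rw [dist_eq]
    exact h.holder y x) h2

theorem continuous_momentum (h : HolderC2Bound f A α) (hα : 0 < α) : Continuous (momentum f) :=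
  h.differentiable.continuous.sub (h.continuous_deriv_deriv hα)

theorem abs_momentum_le (h : HolderC2Bound f A α) (x : ℝ) : |momentum f x| ≤ 2 * A :=
  (abs_sub _ _).trans (by linarith [h.abs_le x, h.abs_deriv_deriv_le x])

theorem abs_momentum_sub_le (h : HolderC2Bound f A α) (hα : 0 ≤ α) {x y ε : ℝ} (hxy : |x - y| ≤ ε) :
    |momentum f y - momentum f x| ≤ A * (ε + ε ^ α) := by
  have hA := h.nonneg
  have h1 : |f y - f x| ≤ A * |y - x| := by
    have := Convex.norm_image_sub_le_of_norm_deriv_le (f := f) (s := univ) (x := x) (y := y)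
      (fun z _ => h.differentiable z) (fun z _ => h.abs_deriv_le z) convex_univ trivial trivial
    simpa using this
  have h2 := h.holder y x
  rw [abs_sub_comm y x] at h1 h2
  have h3 : |x - y| ^ α ≤ ε ^ α := rpow_le_rpow (abs_nonneg _) hxy hα
  have h4 : momentum f y - momentum f x
      = (f y - f x) - (deriv (deriv f) y - deriv (deriv f) x) := by
    simp only [momentum]
    ring
  rw [h4]
  calc _ ≤ _ := abs_sub _ _
    _ ≤ A * |x - y| + A * |x - y| ^ α := add_le_add h1 h2
    _ ≤ A * ε + A * ε ^ α := by gcongr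
    _ = _ := by ring

theorem abs_sq_sub_sq_le (h : HolderC2Bound f A α) (x : ℝ) :
    |f x ^ 2 - deriv f x ^ 2| ≤ A ^ 2 := by
  have h1 := sq_le_sq' (neg_le_of_abs_le (h.abs_le x)) (le_of_abs_le (h.abs_le x))
  have h2 := sq_le_sq' (neg_le_of_abs_le (h.abs_deriv_le x)) (le_of_abs_le (h.abs_deriv_le x))
  rw [_root_.abs_le]
  constructor <;> nlinarith [sq_nonneg (f x), sq_nonneg (deriv f x)]

theorem abs_factor_le (h : HolderC2Bound f A α) (n : ℕ) (x : ℝ) :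
    |factor n f x| ≤ (A ^ 2) ^ (n - 1) := by
  rw [factor, abs_pow]
  exact pow_le_pow_left₀ (abs_nonneg _) (h.abs_sq_sub_sq_le x) _

theorem continuous_factor (h : HolderC2Bound f A α) (n : ℕ) : Continuous (factor n f) :=
  ((h.differentiable.continuous.pow 2).sub (h.differentiable_deriv.continuous.pow 2)).pow _

/-- The speed involves `f` and `f'` only, so its derivative is bounded by `C²` data. For `n = 1` the
truncated exponent `n - 1 - 1` is harmless: its coefficient vanishes. -/
theorem abs_factor_mul_sub_le (h : HolderC2Bound f A α) (n : ℕ) (x y : ℝ) :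
    |factor n f x * f x - factor n f y * f y|
      ≤ (((n - 1 : ℕ) : ℝ) * (A ^ 2) ^ (n - 1 - 1) * (4 * A ^ 2) * A + (A ^ 2) ^ (n - 1) * A)
        * |x - y| := by
  have hA := h.nonneg
  have hd : ∀ z, HasDerivAt (fun z => factor n f z * f z)
      (((n - 1 : ℕ) : ℝ) * (f z ^ 2 - deriv f z ^ 2) ^ (n - 1 - 1)
        * (2 * f z * deriv f z - 2 * deriv f z * deriv (deriv f) z) * f z
        + factor n f z * deriv f z) z := by
    intro z
    have h1 := (h.differentiable z).hasDerivAt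
    have h2 := (h.differentiable_deriv z).hasDerivAt
    have h3 : HasDerivAt (fun z => f z ^ 2 - deriv f z ^ 2)
        (2 * f z * deriv f z - 2 * deriv f z * deriv (deriv f) z) z := by
      simpa using (h1.fun_pow 2).fun_sub (h2.fun_pow 2)
    exact (h3.fun_pow (n - 1)).fun_mul h1
  have hb : ∀ z ∈ univ, ‖((n - 1 : ℕ) : ℝ) * (f z ^ 2 - deriv f z ^ 2) ^ (n - 1 - 1)
        * (2 * f z * deriv f z - 2 * deriv f z * deriv (deriv f) z) * f z
        + factor n f z * deriv f z‖
      ≤ ((n - 1 : ℕ) : ℝ) * (A ^ 2) ^ (n - 1 - 1) * (4 * A ^ 2) * A + (A ^ 2) ^ (n - 1) * A := by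
    intro z _
    have h0 := h.abs_le z
    have h1 := h.abs_deriv_le z
    have h2 := h.abs_deriv_deriv_le z
    have h3 : |2 * f z * deriv f z - 2 * deriv f z * deriv (deriv f) z| ≤ 4 * A ^ 2 := by
      have h4 : |2 * f z * deriv f z| ≤ 2 * A * A := by
        rw [abs_mul, abs_mul, abs_two]
        gcongr
      have h5 : |2 * deriv f z * deriv (deriv f) z| ≤ 2 * A * A := by
        rw [abs_mul, abs_mul, abs_two]
        gcongr
      exact (abs_sub _ _).trans (by nlinarith)
    have h4 : |(f z ^ 2 - deriv f z ^ 2) ^ (n - 1 - 1)| ≤ (A ^ 2) ^ (n - 1 - 1) := by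
      rw [abs_pow]
      exact pow_le_pow_left₀ (abs_nonneg _) (h.abs_sq_sub_sq_le z) _
    have h5 := h.abs_factor_le n z
    rw [norm_eq_abs]
    refine (abs_add_le _ _).trans ?_
    rw [abs_mul, abs_mul, abs_mul, abs_mul, Nat.abs_cast]
    gcongr
  have := Convex.norm_image_sub_le_of_norm_hasDerivWithin_le (s := univ) (x := y) (y := x)
    (fun z _ => (hd z).hasDerivWithinAt) hb convex_univ trivial trivial
  simpa using this

end HolderC2Bound

/-- Both space derivatives go onto `φ`, so that the mollified momentum can be differentiated in time
using `u_t` alone. -/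
theorem integral_momentum_mul {f φ : ℝ → ℝ} (hf : Differentiable ℝ f)
    (hf' : Differentiable ℝ (deriv f)) (hf'' : Continuous (deriv (deriv f)))
    (hφ : ContDiff ℝ ∞ φ) (hφc : HasCompactSupport φ) :
    ∫ x, momentum f x * φ x = ∫ x, f x * (φ x - deriv (deriv φ) x) := by
  have hφ' : ContDiff ℝ ∞ (deriv φ) := (contDiff_infty_iff_deriv.1 hφ).2
  have hφ'' : ContDiff ℝ ∞ (deriv (deriv φ)) := (contDiff_infty_iff_deriv.1 hφ').2
  have hi : ∀ {p q : ℝ → ℝ}, Continuous p → Continuous q → HasCompactSupport q →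
      Integrable (fun x => p x * q x) := fun hp hq hqc =>
    (hp.mul hq).integrable_of_hasCompactSupport hqc.mul_left
  have h1 : ∫ x, deriv f x * deriv φ x = -∫ x, deriv (deriv f) x * φ x :=
    integral_mul_deriv_eq_deriv_mul_of_integrable
      (fun x _ => (hf' x).hasDerivAt) (fun x _ => (hφ.differentiable (by simp) x).hasDerivAt)
      (hi hf'.continuous hφ'.continuous hφc.deriv) (hi hf'' hφ.continuous hφc)
      (hi hf'.continuous hφ.continuous hφc)
  have h2 : ∫ x, f x * deriv (deriv φ) x = -∫ x, deriv f x * deriv φ x :=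
    integral_mul_deriv_eq_deriv_mul_of_integrable
      (fun x _ => (hf x).hasDerivAt) (fun x _ => (hφ'.differentiable (by simp) x).hasDerivAt)
      (hi hf.continuous hφ''.continuous hφc.deriv.deriv)
      (hi hf'.continuous hφ'.continuous hφc.deriv) (hi hf.continuous hφ'.continuous hφc.deriv)
  simp_rw [momentum, sub_mul, mul_sub]
  rw [integral_sub (hi hf.continuous hφ.continuous hφc) (hi hf'' hφ.continuous hφc),
    integral_sub (hi hf.continuous hφ.continuous hφc)
      (hi hf.continuous hφ''.continuous hφc.deriv.deriv), h2, h1, neg_neg]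

/-! ### Persistence of the sign of the momentum. -/

namespace IsStrongSolution

variable {n : ℕ} {s T : ℝ} {u₀ : ℝ → ℝ} {u : ℝ → ℝ → ℝ}

/-- The lifted curve is continuous, hence bounded on the compact interval `[0,τ]`, and the embedding
constant does not depend on time. -/
theorem exists_uniform_holderC2Bound (hu : IsStrongSolution n s T u₀ u) (hs : 5 / 2 < s) {τ : ℝ}
    (hτ : τ < T) : ∃ A α : ℝ, 0 < α ∧ ∀ t ∈ Icc 0 τ, HolderC2Bound (u t) A α := by
  obtain ⟨C, α, hC, hα, h⟩ := exists_holderC2Bound hs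
  obtain ⟨U, hU, hUu⟩ := hu.regularity
  have hsub : Icc 0 τ ⊆ Ico 0 T := fun t ht => ⟨ht.1, ht.2.trans_lt hτ⟩
  obtain ⟨R, hR⟩ := isCompact_Icc.exists_bound_of_continuousOn (hU.continuousOn.mono hsub)
  refine ⟨C * R, α, hα, fun t ht => ?_⟩
  obtain ⟨A, hA, hb⟩ := h (u t) (U t) (hu.continuous t (hsub ht)) (hUu t (hsub ht))
  exact hb.mono (hA.trans (by gcongr; exact hR t ht))

/-- The equation tested against a translate of a mollifier, in the form of a transport equation
with an error term. -/
theorem integral_timeDeriv_add (hu : IsStrongSolution n s T u₀ u) (hs : 5 / 2 < s) {t A α : ℝ}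
    (ht : t ∈ Ico 0 T) (hα : 0 < α) (hb : HolderC2Bound (u t) A α) {ρ : ℝ → ℝ} {ε B : ℝ}
    (hρ : IsMollifier ρ ε B) (x : ℝ) :
    (∫ y, timeDeriv T u t y * (ρ (x - y) - deriv (deriv ρ) (x - y)))
        + factor n (u t) x * u t x * ∫ y, momentum (u t) y * deriv ρ (x - y)
      = (∫ y, (factor n (u t) x * u t x - factor n (u t) y * u t y) * momentum (u t) y
          * deriv ρ (x - y))
        - ∫ y, factor n (u t) y * deriv (u t) y * momentum (u t) y * ρ (x - y) := by
  have hm := hb.continuous_momentum hα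
  have hF := hb.continuous_factor n
  have hc := hb.differentiable.continuous
  have hc' := hb.differentiable_deriv.continuous
  have hut := continuous_timeDeriv (by linarith) hu.continuous hu.regularity_time ht
  have hd1 : deriv (fun y => ρ (x - y)) = fun y => -deriv ρ (x - y) := by
    funext y
    exact deriv_comp_const_sub ρ x y
  have hd2 : deriv (deriv (fun y => ρ (x - y))) = fun y => deriv (deriv ρ) (x - y) := by
    funext y
    rw [hd1]
    simp only [deriv.fun_neg]
    rw [deriv_comp_const_sub (deriv ρ) x y, neg_neg]
  have heq := hu.equation t ht (fun y => ρ (x - y)) (hρ.contDiff.comp (by fun_prop))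
    (IsMollifier.hasCompactSupport_comp_sub hρ.hasCompactSupport x)
  rw [hd2, hd1] at heq
  simp only at heq
  have hi1 : Integrable fun y => timeDeriv T u t y * (ρ (x - y) - deriv (deriv ρ) (x - y)) := by
    have h1 : Continuous fun y => ρ (x - y) := hρ.continuous.comp (by fun_prop)
    have h2 : Continuous fun y => deriv (deriv ρ) (x - y) :=
      hρ.continuous_deriv_deriv.comp (by fun_prop)
    refine (hut.mul (h1.sub h2)).integrable_of_hasCompactSupport (HasCompactSupport.mul_left ?_)
    exact (IsMollifier.hasCompactSupport_comp_sub hρ.hasCompactSupport x).sub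
      (IsMollifier.hasCompactSupport_comp_sub hρ.hasCompactSupport_deriv.deriv x)
  have hi2 : Integrable fun y =>
      factor n (u t) y * deriv (u t) y * momentum (u t) y * ρ (x - y) :=
    hρ.integrable_mul_sub ((hF.mul hc').mul hm) x
  have hi3 : Integrable fun y =>
      factor n (u t) y * u t y * momentum (u t) y * deriv ρ (x - y) :=
    hρ.integrable_mul_deriv_sub ((hF.mul hc).mul hm) x
  have hi4 := (hρ.integrable_mul_deriv_sub hm x).const_mul (factor n (u t) x * u t x)
  simp only [mul_neg, sub_neg_eq_add] at heq
  rw [integral_add (hi1.fun_add hi2) hi3, integral_add hi1 hi2] at heq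
  have h5 : (∫ y, (factor n (u t) x * u t x - factor n (u t) y * u t y) * momentum (u t) y
          * deriv ρ (x - y))
      = factor n (u t) x * u t x * (∫ y, momentum (u t) y * deriv ρ (x - y))
        - ∫ y, factor n (u t) y * u t y * momentum (u t) y * deriv ρ (x - y) := by
    rw [← integral_const_mul, ← integral_sub hi4 hi3]
    refine integral_congr_ae (Eventually.of_forall fun y => ?_)
    simp only
    ring
  rw [h5]
  linarith

/-- The momentum density stays nonnegative along a strong solution. -/
theorem momentum_nonneg (hu : IsStrongSolution n s T u₀ u) (hs : 5 / 2 < s)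
    (hm₀ : ∀ x, 0 ≤ momentum u₀ x) {τ : ℝ} (hτ : τ ∈ Ico 0 T) (x : ℝ) :
    0 ≤ momentum (u τ) x := by
  obtain ⟨A, α, hα, hA⟩ := hu.exists_uniform_holderC2Bound hs hτ.2
  obtain ⟨B, hB, hmol⟩ := exists_isMollifier
  have hsub : Icc 0 τ ⊆ Ico 0 T := fun t ht => ⟨ht.1, ht.2.trans_lt hτ.2⟩
  have hA0 : 0 ≤ A := (hA 0 ⟨le_rfl, hτ.1⟩).nonneg
  set L : ℝ := ((n - 1 : ℕ) : ℝ) * (A ^ 2) ^ (n - 1 - 1) * (4 * A ^ 2) * A + (A ^ 2) ^ (n - 1) * A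
    with hL
  have hL0 : 0 ≤ L := by positivity
  set C : ℝ := (A ^ 2) ^ (n - 1) * A with hC
  have hC0 : 0 ≤ C := by positivity
  set K : ℝ := L * B + C with hK
  have hK0 : 0 ≤ K := by positivity
  -- The minimum principle with `δ = 2θ` contributes `2θ exp(2Kτ)`; passing from the mollified
  -- momentum back to `m` contributes one more `θ`.
  have key : ∀ ε > 0, -(A * (ε + ε ^ α) * (2 * exp (2 * K * τ) + 1)) ≤ momentum (u τ) x := by
    intro ε hε
    obtain ⟨ρ, hρ⟩ := hmol ε hε
    set θ := A * (ε + ε ^ α) with hθ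
    have hθ0 : 0 ≤ θ := by positivity
    set w : ℝ → ℝ → ℝ := fun t x => ∫ y, momentum (u t) y * ρ (x - y) with hw
    have hw2 : ∀ t ∈ Icc 0 τ, ∀ x,
        w t x = ∫ y, u t y * (ρ (x - y) - deriv (deriv ρ) (x - y)) := by
      intro t ht x
      have hb := hA t ht
      have h1 := integral_momentum_mul hb.differentiable hb.differentiable_deriv
        (hb.continuous_deriv_deriv hα) (φ := fun y => ρ (x - y))
        (hρ.contDiff.comp (by fun_prop))
        (IsMollifier.hasCompactSupport_comp_sub hρ.hasCompactSupport x)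
      simp only [hw]
      rw [h1]
      refine integral_congr_ae (Eventually.of_forall fun y => ?_)
      simp only
      have hd1 : deriv (fun y => ρ (x - y)) = fun y => -deriv ρ (x - y) := by
        funext y
        exact deriv_comp_const_sub ρ x y
      rw [hd1, deriv.fun_neg, deriv_comp_const_sub (deriv ρ) x y, neg_neg]
    have hwt : ∀ t ∈ Icc 0 τ, ∀ x, HasDerivWithinAt (fun r => w r x)
        (∫ y, timeDeriv T u t y * (ρ (x - y) - deriv (deriv ρ) (x - y))) (Icc 0 τ) t := by
      intro t ht x
      have h1 : Continuous fun y => ρ (x - y) := hρ.continuous.comp (by fun_prop)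
      have h2 : Continuous fun y => deriv (deriv ρ) (x - y) :=
        hρ.continuous_deriv_deriv.comp (by fun_prop)
      have h3 := hasDerivWithinAt_integral_mul (by linarith) hu.continuous hu.regularity_time
        (h1.sub h2) ((IsMollifier.hasCompactSupport_comp_sub hρ.hasCompactSupport x).sub
          (IsMollifier.hasCompactSupport_comp_sub hρ.hasCompactSupport_deriv.deriv x)) (hsub ht)
      exact (h3.mono hsub).congr (fun r hr => hw2 r hr x) (hw2 t ht x)
    have hwx : ∀ t ∈ Icc 0 τ, ∀ x,
        HasDerivAt (w t) (∫ y, momentum (u t) y * deriv ρ (x - y)) x := fun t ht x =>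
      hρ.hasDerivAt_integral_mul ((hA t ht).continuous_momentum hα) x
    -- Joint continuity follows from continuity in `t` at fixed `x` and a Lipschitz bound in `x`
    -- uniform in `t`.
    have hwc : ContinuousOn (fun p : ℝ × ℝ => w p.1 p.2) (Icc 0 τ ×ˢ univ) := by
      refine continuousOn_prod_of_continuousOn_lipschitzOnWith' _ (Real.toNNReal (2 * A * (B / ε)))
        (fun t ht => ?_) (fun x _ t ht => (hwt t ht x).continuousWithinAt)
      refine LipschitzOnWith.of_dist_le_mul fun x _ y _ => ?_
      rw [Real.coe_toNNReal _ (by positivity), dist_eq, dist_eq]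
      have := Convex.norm_image_sub_le_of_norm_hasDerivWithin_le (s := univ) (x := y) (y := x)
        (f := w t) (C := 2 * A * (B / ε))
        (fun z _ => (hwx t ht z).hasDerivWithinAt) (fun z _ => ?_) convex_univ trivial trivial
      · simpa using this
      · calc ‖∫ y, momentum (u t) y * deriv ρ (z - y)‖ ≤ ∫ y, 2 * A * |deriv ρ (z - y)| := by
              refine norm_integral_le_of_norm_le ((hρ.integrable_abs_deriv_sub z).const_mul _)
                (Eventually.of_forall fun y => ?_)
              rw [norm_mul, norm_eq_abs, norm_eq_abs]
              exact mul_le_mul_of_nonneg_right ((hA t ht).abs_momentum_le y) (abs_nonneg _)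
          _ ≤ _ := by
              rw [integral_const_mul]
              exact mul_le_mul_of_nonneg_left (hρ.integral_abs_deriv_sub_le z) (by positivity)
    have hmain := neg_mul_exp_le_of_transport (w := w)
      (w' := fun t x => ∫ y, timeDeriv T u t y * (ρ (x - y) - deriv (deriv ρ) (x - y)))
      (v := fun t x => ∫ y, momentum (u t) y * deriv ρ (x - y))
      (b := fun t x => factor n (u t) x * u t x) (τ := τ) (K := K) (δ := 2 * θ) (B := C)
      (W := 2 * A) hK0 (by positivity) hwc hwt hwx
      (fun t ht x => by
        rw [abs_mul]
        exact mul_le_mul ((hA t ht).abs_factor_le n x) ((hA t ht).abs_le x) (abs_nonneg _)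
          (by positivity))
      (fun t ht x => hρ.abs_integral_mul_le fun y _ => (hA t ht).abs_momentum_le y)
      (fun t ht x => by
        rw [hu.integral_timeDeriv_add hs (hsub ht) hα (hA t ht) hρ x]
        refine hρ.abs_commutator_le hε ((hA t ht).continuous_momentum hα)
          (b := fun y => factor n (u t) y * u t y)
          (c := fun y => factor n (u t) y * deriv (u t) y) hL0 hC0
          (fun y => (hA t ht).abs_factor_mul_sub_le n x y) (fun y => ?_)
          (fun y hy => (hA t ht).abs_momentum_sub_le hα.le hy)
        rw [abs_mul]
        exact mul_le_mul ((hA t ht).abs_factor_le n y) ((hA t ht).abs_deriv_le y) (abs_nonneg _)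
          (by positivity))
      (fun x => integral_nonneg fun y => by
        simp only [hu.initial]
        exact mul_nonneg (hm₀ y) (hρ.nonneg _))
      ⟨hτ.1, le_rfl⟩ x
    have hlast := abs_le.1 (hρ.abs_integral_sub_le ((hA τ ⟨hτ.1, le_rfl⟩).continuous_momentum hα)
      (x := x) (θ := θ) fun y hy => (hA τ ⟨hτ.1, le_rfl⟩).abs_momentum_sub_le hα.le hy)
    have : w τ x = ∫ y, momentum (u τ) y * ρ (x - y) := rfl
    linarith [hlast.2]
  have hlim : Tendsto (fun ε : ℝ => -(A * (ε + ε ^ α) * (2 * exp (2 * K * τ) + 1))) (𝓝[>] 0)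
      (𝓝 0) := by
    have h1 : Continuous fun ε : ℝ => -(A * (ε + ε ^ α) * (2 * exp (2 * K * τ) + 1)) := by
      have : Continuous fun ε : ℝ => ε ^ α := continuous_id.rpow_const fun _ => Or.inr hα.le
      fun_prop
    have h2 := (h1.tendsto 0).mono_left (nhdsWithin_le_nhds (s := Ioi 0))
    simpa [zero_rpow hα.ne'] using h2
  exact le_of_tendsto hlim (eventually_mem_nhdsWithin.mono fun ε hε => key ε hε)

end IsStrongSolution

/-! ### Pointwise bounds for the integrand of `H₂`. -/

/-- The integrand of `H₂`, as a function of `u` and `u_x`. -/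
def density (n : ℕ) (u v : ℝ) : ℝ :=
  u ^ (2 * n + 1) + ∑ k ∈ Finset.Icc 1 n,
    (-1 : ℝ) ^ (k + 1) / (2 * (k : ℝ) - 1) * (n.choose k : ℝ)
      * u ^ (2 * n - 2 * k + 1) * v ^ (2 * k)

/-- The dehomogenization of `density`. -/
def profile (n : ℕ) (w : ℝ) : ℝ :=
  1 + ∑ k ∈ Finset.range n,
    (-1 : ℝ) ^ k / (2 * (k : ℝ) + 1) * (n.choose (k + 1) : ℝ) * w ^ (2 * k + 2)

/-- The derivative of `profile`. -/
def profileDeriv (n : ℕ) (w : ℝ) : ℝ :=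
  ∑ k ∈ Finset.range n,
    (-1 : ℝ) ^ k / (2 * (k : ℝ) + 1) * (n.choose (k + 1) : ℝ) * ((2 * k + 2) * w ^ (2 * k + 1))

theorem sum_Icc_one_eq_sum_range (n : ℕ) (f : ℕ → ℝ) :
    ∑ k ∈ Finset.Icc 1 n, f k = ∑ k ∈ Finset.range n, f (k + 1) := by
  rw [← Finset.Ico_add_one_right_eq_Icc, Finset.sum_Ico_eq_sum_range]
  simp [add_comm]

theorem density_eq (n : ℕ) (u v : ℝ) (hu : u ≠ 0) :
    density n u v = u ^ (2 * n + 1) * profile n (v / u) := by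
  rw [density, profile, sum_Icc_one_eq_sum_range, mul_add, mul_one, Finset.mul_sum]
  congr 1
  refine Finset.sum_congr rfl fun k hk => ?_
  have hk' : k < n := Finset.mem_range.1 hk
  have h1 : u ^ (2 * n + 1) = u ^ (2 * n - 2 * (k + 1) + 1) * u ^ (2 * k + 2) := by
    rw [← pow_add]
    congr 1
    omega
  have h2 : (2 * ((k + 1 : ℕ) : ℝ) - 1) = 2 * (k : ℝ) + 1 := by
    push_cast
    ring
  rw [h1, h2, div_pow, pow_add (-1 : ℝ) (k + 1) 1, pow_succ (-1 : ℝ) k,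
    show 2 * (k + 1) = 2 * k + 2 by ring]
  field_simp

theorem hasDerivAt_profile (n : ℕ) (w : ℝ) : HasDerivAt (profile n) (profileDeriv n w) w := by
  have h := HasDerivAt.fun_sum (u := Finset.range n) (x := w) fun k _ =>
    (hasDerivAt_pow (2 * k + 2) w).const_mul
      ((-1 : ℝ) ^ k / (2 * (k : ℝ) + 1) * (n.choose (k + 1) : ℝ))
  convert! h.const_add 1 using 1
  simp [profileDeriv]

/-- The factor `2k + 1` cancels the denominator, and `(k+1) C(n,k+1) = n C(n-1,k)` leaves a binomial
expansion. -/
theorem hasDerivAt_profileDeriv (n : ℕ) (w : ℝ) :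
    HasDerivAt (profileDeriv n) (2 * n * (1 - w ^ 2) ^ (n - 1)) w := by
  have h := HasDerivAt.fun_sum (u := Finset.range n) (x := w) fun k _ =>
    ((hasDerivAt_pow (2 * k + 1) w).const_mul ((2 * k + 2 : ℝ))).const_mul
      ((-1 : ℝ) ^ k / (2 * (k : ℝ) + 1) * (n.choose (k + 1) : ℝ))
  convert! h using 1
  cases n with
  | zero => simp
  | succ N =>
    rw [Nat.add_sub_cancel, sub_eq_neg_add, add_pow, Finset.mul_sum]
    refine Finset.sum_congr rfl fun k hk => ?_
    have h1 : ((N + 1 : ℕ) : ℝ) * (N.choose k : ℝ)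
        = ((N + 1).choose (k + 1) : ℝ) * ((k : ℝ) + 1) := by
      exact_mod_cast Nat.add_one_mul_choose_eq N k
    have h2 : (2 * (k : ℝ) + 1) ≠ 0 := by positivity
    have h3 : (-w ^ 2) ^ k = (-1) ^ k * w ^ (2 * k) := by
      rw [neg_pow, pow_mul]
    rw [h3, one_pow, mul_one, Nat.add_sub_cancel]
    push_cast at h1 ⊢
    field_simp
    linear_combination w ^ (2 * k) * h1

theorem sum_neg_one_pow_choose_succ {n : ℕ} (hn : 1 ≤ n) :
    ∑ k ∈ Finset.range n, (-1 : ℝ) ^ k * (n.choose (k + 1) : ℝ) = 1 := by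
  have h := Int.alternating_sum_range_choose_of_ne (n := n) (by omega)
  rw [Finset.sum_range_succ'] at h
  have h2 : ∑ k ∈ Finset.range n, (-1 : ℝ) ^ (k + 1) * (n.choose (k + 1) : ℝ) + 1 = 0 := by
    have := congrArg (fun z : ℤ => (z : ℝ)) h
    simpa using this
  have h3 : ∑ k ∈ Finset.range n, (-1 : ℝ) ^ (k + 1) * (n.choose (k + 1) : ℝ)
      = -∑ k ∈ Finset.range n, (-1 : ℝ) ^ k * (n.choose (k + 1) : ℝ) := by
    rw [← Finset.sum_neg_distrib]
    refine Finset.sum_congr rfl fun k _ => ?_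
    ring
  linarith

/-- Write `(2j-3)/(2(2j-1)) = 1/2 - 1/(2j-1)`; the alternating binomial sum equals `1`. -/
theorem two_sub_c₁ {n : ℕ} (hn : 1 ≤ n) : 2 - c₁ n = profile n 1 := by
  have h1 : ∑ j ∈ Finset.Icc 1 n,
      (-1 : ℝ) ^ (j + 1) * ((2 * (j : ℝ) - 3) / (2 * (2 * (j : ℝ) - 1))) * (n.choose j : ℝ)
      = 1 / 2 * ∑ k ∈ Finset.range n, (-1 : ℝ) ^ k * (n.choose (k + 1) : ℝ)
        - ∑ k ∈ Finset.range n, (-1 : ℝ) ^ k / (2 * (k : ℝ) + 1) * (n.choose (k + 1) : ℝ) := by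
    rw [sum_Icc_one_eq_sum_range, Finset.mul_sum, ← Finset.sum_sub_distrib]
    refine Finset.sum_congr rfl fun k _ => ?_
    have h2 : (2 * ((k + 1 : ℕ) : ℝ) - 1) = 2 * (k : ℝ) + 1 := by
      push_cast
      ring
    have h3 : (2 * ((k + 1 : ℕ) : ℝ) - 3) = 2 * (k : ℝ) - 1 := by
      push_cast
      ring
    have h4 : (2 * (k : ℝ) + 1) ≠ 0 := by positivity
    rw [h2, h3, pow_add (-1 : ℝ) (k + 1) 1, pow_succ (-1 : ℝ) k]
    field_simp
    ring
  rw [c₁, h1, sum_neg_one_pow_choose_succ hn, profile]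
  simp only [one_pow, mul_one]
  ring

/-- Termwise `(2k+2)/(2k+1) = 1 + 1/(2k+1)`, and the alternating binomial sum supplies the constant
term of `profile`. -/
theorem profileDeriv_one {n : ℕ} (hn : 1 ≤ n) : profileDeriv n 1 = profile n 1 := by
  have h : profileDeriv n 1 = ∑ k ∈ Finset.range n, (-1 : ℝ) ^ k * (n.choose (k + 1) : ℝ)
      + ∑ k ∈ Finset.range n,
        (-1 : ℝ) ^ k / (2 * (k : ℝ) + 1) * (n.choose (k + 1) : ℝ) * 1 ^ (2 * k + 2) := by
    rw [profileDeriv, ← Finset.sum_add_distrib]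
    refine Finset.sum_congr rfl fun k _ => ?_
    have h4 : (2 * (k : ℝ) + 1) ≠ 0 := by positivity
    simp only [one_pow, mul_one]
    field_simp
    ring
  rw [h, sum_neg_one_pow_choose_succ hn, profile]

/-- A concave function lies above its chord, here from `(0, 0)` to `(1, profile n 1)`. -/
theorem mul_profile_one_le_profileDeriv {n : ℕ} (hn : 1 ≤ n) {w : ℝ} (h0 : 0 ≤ w) (h1 : w ≤ 1) :
    w * profile n 1 ≤ profileDeriv n w := by
  have hconc : ConcaveOn ℝ (Icc 0 1) (profileDeriv n) := by
    refine AntitoneOn.concaveOn_of_deriv (convex_Icc 0 1)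
      (fun x _ => (hasDerivAt_profileDeriv n x).continuousAt.continuousWithinAt)
      (fun x _ => (hasDerivAt_profileDeriv n x).differentiableAt.differentiableWithinAt) ?_
    intro x hx y hy hxy
    rw [interior_Icc] at hx hy
    rw [(hasDerivAt_profileDeriv n x).deriv, (hasDerivAt_profileDeriv n y).deriv]
    have h2 : 0 ≤ 1 - y ^ 2 := by nlinarith [hy.1, hy.2]
    have h3 : 1 - y ^ 2 ≤ 1 - x ^ 2 := by nlinarith [hx.1]
    gcongr
  have h := hconc.2 (left_mem_Icc.2 zero_le_one) (right_mem_Icc.2 zero_le_one)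
    (sub_nonneg.2 h1) h0 (by ring)
  have hz : profileDeriv n 0 = 0 := by simp [profileDeriv]
  simpa [hz, profileDeriv_one hn] using h

theorem profile_neg (n : ℕ) (w : ℝ) : profile n (-w) = profile n w := by
  simp only [profile]
  congr 1
  refine Finset.sum_congr rfl fun k _ => ?_
  rw [Even.neg_pow (n := 2 * k + 2) ⟨k + 1, by ring⟩]

/-- By evenness take `w ≥ 0`: the difference of the two sides is nonincreasing on `[0,1]` and
vanishes at `1`. -/
theorem profile_le {n : ℕ} (hn : 1 ≤ n) {w : ℝ} (hw : |w| ≤ 1) :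
    profile n w ≤ profile n 1 / 2 * (1 + w ^ 2) := by
  wlog h0 : 0 ≤ w generalizing w
  · have := this (w := -w) (by rwa [abs_neg]) (by linarith)
    rwa [profile_neg, neg_sq] at this
  have h1 : w ≤ 1 := (le_abs_self w).trans hw
  have hd : ∀ x, HasDerivAt (fun x => profile n 1 / 2 * (1 + x ^ 2) - profile n x)
      (profile n 1 * x - profileDeriv n x) x := by
    intro x
    have h2 : HasDerivAt (fun x : ℝ => profile n 1 / 2 * (1 + x ^ 2)) (profile n 1 * x) x := by
      convert! ((hasDerivAt_pow 2 x).const_add 1).const_mul (profile n 1 / 2) using 1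
      simp
      ring
    exact h2.fun_sub (hasDerivAt_profile n x)
  have hanti : AntitoneOn (fun x => profile n 1 / 2 * (1 + x ^ 2) - profile n x) (Icc 0 1) := by
    refine antitoneOn_of_deriv_nonpos (convex_Icc 0 1)
      (fun x _ => (hd x).continuousAt.continuousWithinAt)
      (fun x _ => (hd x).differentiableAt.differentiableWithinAt) fun x hx => ?_
    rw [interior_Icc] at hx
    rw [(hd x).deriv]
    have := mul_profile_one_le_profileDeriv hn hx.1.le hx.2.le
    linarith
  have h2 := hanti ⟨h0, h1⟩ (right_mem_Icc.2 zero_le_one) h1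
  simp only at h2
  linarith

theorem two_le_profile_one {n : ℕ} (hn : 1 ≤ n) : 2 ≤ profile n 1 := by
  have h := profile_le hn (w := 0) (by simp)
  have h0 : profile n 0 = 1 := by simp [profile]
  rw [h0] at h
  linarith

theorem density_le {n : ℕ} (hn : 1 ≤ n) {u v : ℝ} (h : |v| ≤ u) :
    density n u v ≤ profile n 1 / 2 * u ^ (2 * n - 1) * (u ^ 2 + v ^ 2) := by
  rcases ((abs_nonneg v).trans h).eq_or_lt with hu | hu
  · have hv : v = 0 := abs_eq_zero.1 (le_antisymm (hu ▸ h) (abs_nonneg v))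
    subst hv
    rw [← hu, density, zero_pow (by omega), Finset.sum_eq_zero fun k _ => by simp]
    simp
  · rw [density_eq n u v hu.ne']
    have hw : |v / u| ≤ 1 := by
      rw [abs_div, abs_of_pos hu]
      exact div_le_one_of_le₀ h hu.le
    have h1 := mul_le_mul_of_nonneg_left (profile_le hn hw) (pow_pos hu (2 * n + 1)).le
    refine h1.trans (le_of_eq ?_)
    rw [show 2 * n + 1 = (2 * n - 1) + 2 by omega, pow_add]
    field_simp

/-- Adds `(a/2)(M^(2n-1) - u^(2n-1))(u + v)² ≥ 0`, with `a = profile n 1`, to `density_le`. For `v =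
f'` the cross term is an exact derivative. -/
theorem density_le_of_le {n : ℕ} (hn : 1 ≤ n) {u v M : ℝ} (h : |v| ≤ u) (hM : u ≤ M) :
    density n u v ≤ profile n 1 / 2 * M ^ (2 * n - 1) * (u ^ 2 + v ^ 2)
      + profile n 1 * ((M ^ (2 * n - 1) * u - u ^ (2 * n)) * v) := by
  have hu : 0 ≤ u := (abs_nonneg v).trans h
  have ha := two_le_profile_one hn
  have h1 : u ^ (2 * n - 1) ≤ M ^ (2 * n - 1) := pow_le_pow_left₀ hu hM _
  have h2 : 0 ≤ profile n 1 / 2 * (M ^ (2 * n - 1) - u ^ (2 * n - 1)) * (u + v) ^ 2 := by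
    have := sub_nonneg.2 h1
    positivity
  have h3 : u ^ (2 * n) = u ^ (2 * n - 1) * u := by
    rw [← pow_succ]
    congr 1
    omega
  have h4 := density_le hn h
  rw [h3]
  nlinarith

theorem density_neg (n : ℕ) (u v : ℝ) : density n u (-v) = density n u v := by
  simp only [density]
  congr 1
  refine Finset.sum_congr rfl fun k _ => ?_
  rw [Even.neg_pow (even_two_mul k)]

/-- A crude two-sided bound, used for the integrability of the integrand of `H₂`. -/
theorem exists_abs_density_le (n : ℕ) : ∃ D, 0 ≤ D ∧ ∀ u v : ℝ, |v| ≤ u →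
    |density n u v| ≤ D * u ^ (2 * n + 1) := by
  refine ⟨1 + ∑ k ∈ Finset.Icc 1 n,
    |(-1 : ℝ) ^ (k + 1) / (2 * (k : ℝ) - 1) * (n.choose k : ℝ)|, by positivity,
    fun u v h => ?_⟩
  have hu : 0 ≤ u := (abs_nonneg v).trans h
  rw [density, add_mul, one_mul, Finset.sum_mul]
  refine (abs_add_le _ _).trans (add_le_add (by rw [abs_of_nonneg (by positivity)])
    ((Finset.abs_sum_le_sum_abs _ _).trans (Finset.sum_le_sum fun k hk => ?_)))
  have hk' := (Finset.mem_Icc.1 hk).2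
  rw [abs_mul, abs_mul _ (u ^ _), mul_assoc, abs_pow, abs_pow, abs_of_nonneg hu]
  refine mul_le_mul_of_nonneg_left ?_ (abs_nonneg _)
  calc u ^ (2 * n - 2 * k + 1) * |v| ^ (2 * k) ≤ u ^ (2 * n - 2 * k + 1) * u ^ (2 * k) := by gcongr
    _ = _ := by
      rw [← pow_add]
      congr 1
      omega

/-! ### The inequality for a fixed function. -/

section Static

variable {f : ℝ → ℝ}

/-- A bounded function with bounded derivative and nonnegative momentum dominates its derivative. -/
theorem abs_deriv_le_of_momentum_nonneg (hf : Differentiable ℝ f) (hf' : Differentiable ℝ (deriv f))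
    {A : ℝ} (h0 : ∀ x, |f x| ≤ A) (h1 : ∀ x, |deriv f x| ≤ A) (hm : ∀ x, 0 ≤ momentum f x) (x : ℝ) :
    |deriv f x| ≤ f x := by
  have hd0 := fun x => (hf x).hasDerivAt
  have hd1 := fun x => (hf' x).hasDerivAt
  -- The derivative is `-exp(-y) m ≤ 0` and boundedness gives the limit `0` at `+∞`; `hdiff` is the
  -- mirror image at `-∞`.
  have hsum : 0 ≤ exp (-x) * (f x + deriv f x) := by
    have hd : ∀ y, HasDerivAt (fun y => exp (-y) * (f y + deriv f y))
        (-(exp (-y) * momentum f y)) y := by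
      intro y
      convert! (hasDerivAt_neg y).exp.fun_mul ((hd0 y).fun_add (hd1 y)) using 1
      simp only [momentum]
      ring
    have hanti : Antitone fun y => exp (-y) * (f y + deriv f y) :=
      antitone_of_deriv_nonpos (fun y => (hd y).differentiableAt) fun y => by
        rw [(hd y).deriv]
        have := mul_nonneg (exp_pos (-y)).le (hm y)
        linarith
    refine hanti.le_of_tendsto ?_ x
    refine squeeze_zero_norm (a := fun y => exp (-y) * (2 * A)) (fun y => ?_) ?_
    · rw [norm_mul, norm_eq_abs, norm_eq_abs, abs_of_pos (exp_pos _)]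
      gcongr
      exact (abs_add_le _ _).trans (by linarith [h0 y, h1 y])
    · simpa using (tendsto_exp_neg_atTop_nhds_zero).mul_const (2 * A)
  have hdiff : 0 ≤ exp x * (f x - deriv f x) := by
    have hd : ∀ y, HasDerivAt (fun y => exp y * (f y - deriv f y)) (exp y * momentum f y) y := by
      intro y
      convert! (hasDerivAt_exp y).fun_mul ((hd0 y).fun_sub (hd1 y)) using 1
      simp only [momentum]
      ring
    have hmono : Monotone fun y => exp y * (f y - deriv f y) :=
      monotone_of_deriv_nonneg (fun y => (hd y).differentiableAt) fun y => by
        rw [(hd y).deriv]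
        exact mul_nonneg (exp_pos y).le (hm y)
    refine hmono.le_of_tendsto ?_ x
    refine squeeze_zero_norm (a := fun y => exp y * (2 * A)) (fun y => ?_) ?_
    · rw [norm_mul, norm_eq_abs, norm_eq_abs, abs_of_pos (exp_pos _)]
      gcongr
      exact (abs_sub _ _).trans (by linarith [h0 y, h1 y])
    · simpa using (tendsto_exp_atBot).mul_const (2 * A)
  have h2 := nonneg_of_mul_nonneg_right hsum (exp_pos _)
  have h3 := nonneg_of_mul_nonneg_right hdiff (exp_pos _)
  exact abs_le.2 ⟨by linarith, by linarith⟩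

theorem exists_forall_le_of_tendsto_cocompact (hf : Continuous f) (h0 : ∀ x, 0 ≤ f x)
    (hlim : Tendsto f (cocompact ℝ) (𝓝 0)) : ∃ ξ, ∀ x, f x ≤ f ξ := by
  by_cases h : ∃ x₀, 0 < f x₀
  · obtain ⟨x₀, hx₀⟩ := h
    exact hf.exists_forall_ge' x₀ ((hlim.eventually (gt_mem_nhds hx₀)).mono fun x hx => hx.le)
  · push Not at h
    exact ⟨0, fun x => (h x).trans (h0 0)⟩

/-- The inequality between `H₁`, `H₂` and the maximum, for a function dominating its derivative. -/
theorem max_inequality {n : ℕ} (hn : 1 ≤ n) (hf : Differentiable ℝ f)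
    (hf' : Continuous (deriv f)) (hdom : ∀ x, |deriv f x| ≤ f x)
    (hintg : Integrable fun x => f x ^ 2) (hlim : Tendsto f (cocompact ℝ) (𝓝 0)) {ξ : ℝ}
    (hξ : ∀ x, f x ≤ f ξ) :
    (2 * (n : ℝ) - 1) * (2 - c₁ n) / (2 * (n : ℝ) + 1) * f ξ ^ (2 * n + 1)
        - (2 - c₁ n) / 2 * f ξ ^ (2 * n - 1) * H₁ f + H₂ n f ≤ 0 := by
  rw [two_sub_c₁ hn]
  set a := profile n 1 with ha
  set M := f ξ with hM
  have hf0 : ∀ x, 0 ≤ f x := fun x => (abs_nonneg _).trans (hdom x)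
  have hM0 : 0 ≤ M := hf0 ξ
  have hsq : ∀ x, deriv f x ^ 2 ≤ f x ^ 2 := fun x =>
    sq_le_sq' (neg_le_of_abs_le (hdom x)) (le_of_abs_le (hdom x))
  have hi1 : Integrable fun x => f x ^ 2 + deriv f x ^ 2 := by
    refine hintg.add (hintg.mono' (hf'.pow 2).aestronglyMeasurable
      (Eventually.of_forall fun x => ?_))
    rw [norm_eq_abs, abs_of_nonneg (sq_nonneg _)]
    exact hsq x
  have hpow : ∀ x, f x ^ (2 * n - 1) ≤ M ^ (2 * n - 1) := fun x =>
    pow_le_pow_left₀ (hf0 x) (hξ x) _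
  have hcf := hf.continuous
  have hi2 : Integrable fun x => density n (f x) (deriv f x) := by
    obtain ⟨D, hD, hDb⟩ := exists_abs_density_le n
    refine (hintg.const_mul (D * M ^ (2 * n - 1))).mono' ?_ (Eventually.of_forall fun x => ?_)
    · have : Continuous fun x => density n (f x) (deriv f x) := by
        simp only [density]
        fun_prop
      exact this.aestronglyMeasurable
    · refine (hDb _ _ (hdom x)).trans ?_
      rw [show 2 * n + 1 = (2 * n - 1) + 2 by omega, pow_add, ← mul_assoc]
      have := hpow x
      gcongr
  set k : ℝ → ℝ := fun x => (M ^ (2 * n - 1) * f x - f x ^ (2 * n)) * deriv f x with hk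
  have hi3 : Integrable k := by
    refine (hintg.const_mul (M ^ (2 * n - 1))).mono' ?_ (Eventually.of_forall fun x => ?_)
    · have : Continuous k := by
        simp only [hk]
        fun_prop
      exact this.aestronglyMeasurable
    · have h1 : f x ^ (2 * n) = f x ^ (2 * n - 1) * f x := by
        rw [← pow_succ]
        congr 1
        omega
      have h2 : 0 ≤ M ^ (2 * n - 1) * f x - f x ^ (2 * n) := by
        rw [h1, ← sub_mul]
        exact mul_nonneg (sub_nonneg.2 (hpow x)) (hf0 x)
      have h3 : 0 ≤ f x ^ (2 * n) := pow_nonneg (hf0 x) _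
      rw [hk, norm_mul, norm_eq_abs, norm_eq_abs, abs_of_nonneg h2, pow_two, ← mul_assoc]
      exact mul_le_mul (by linarith) (hdom x) (abs_nonneg _)
        (mul_nonneg (pow_nonneg hM0 _) (hf0 x))
  -- A primitive of the cross term `k`, vanishing at both ends, so each half-line contributes only
  -- its value at `ξ`.
  set p : ℝ → ℝ := fun x => M ^ (2 * n - 1) * (f x ^ 2 / 2) - f x ^ (2 * n + 1) / (2 * n + 1)
    with hp
  have hpd : ∀ x, HasDerivAt p (k x) x := by
    intro x
    have h1 := (hf x).hasDerivAt
    have h2 := (((h1.fun_pow 2).div_const 2).const_mul (M ^ (2 * n - 1))).fun_sub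
      ((h1.fun_pow (2 * n + 1)).div_const (2 * (n : ℝ) + 1))
    convert! h2 using 1
    simp only [hk]
    push_cast
    field_simp
  have hp0 : Tendsto p (cocompact ℝ) (𝓝 0) := by
    have hc : Continuous fun z : ℝ =>
        M ^ (2 * n - 1) * (z ^ 2 / 2) - z ^ (2 * n + 1) / (2 * (n : ℝ) + 1) := by fun_prop
    have h1 := (hc.tendsto 0).comp hlim
    have h2 : M ^ (2 * n - 1) * ((0 : ℝ) ^ 2 / 2) - 0 ^ (2 * n + 1) / (2 * (n : ℝ) + 1) = 0 := by
      simp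
    rwa [h2] at h1
  have hIoi : ∫ x in Ioi ξ, k x = -p ξ := by
    rw [integral_Ioi_of_hasDerivAt_of_tendsto' (fun x _ => hpd x) hi3.integrableOn
      (hp0.mono_left atTop_le_cocompact), zero_sub]
  have hIic : ∫ x in Iic ξ, k x = p ξ := by
    rw [integral_Iic_of_hasDerivAt_of_tendsto' (fun x _ => hpd x) hi3.integrableOn
      (hp0.mono_left atBot_le_cocompact), sub_zero]
  set c := a / 2 * M ^ (2 * n - 1) with hc
  have hR : ∫ x in Ioi ξ, density n (f x) (deriv f x)
      ≤ c * (∫ x in Ioi ξ, (f x ^ 2 + deriv f x ^ 2)) - a * p ξ := by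
    have h1 := integral_mono (μ := volume.restrict (Ioi ξ)) hi2.integrableOn
      ((hi1.const_mul c).add (hi3.const_mul a)).integrableOn
      fun x => density_le_of_le hn (hdom x) (hξ x)
    refine h1.trans (le_of_eq ?_)
    rw [integral_add' (hi1.const_mul c).integrableOn (hi3.const_mul a).integrableOn,
      integral_const_mul, integral_const_mul, hIoi]
    ring
  -- The integrand is even in `f'`, so the bound holds with `-f'`; the flipped cross term makes both
  -- sides of `ξ` contribute `-a * p ξ`.
  have hL : ∫ x in Iic ξ, density n (f x) (deriv f x)
      ≤ c * (∫ x in Iic ξ, (f x ^ 2 + deriv f x ^ 2)) - a * p ξ := by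
    have h1 := integral_mono (μ := volume.restrict (Iic ξ)) hi2.integrableOn
      ((hi1.const_mul c).sub (hi3.const_mul a)).integrableOn
      fun x => by
        have h2 := density_le_of_le hn (v := -deriv f x) (by rw [abs_neg]; exact hdom x) (hξ x)
        rw [density_neg, neg_sq] at h2
        refine h2.trans (le_of_eq ?_)
        simp only [Pi.sub_apply, hk, hc, ha]
        ring
    refine h1.trans (le_of_eq ?_)
    rw [integral_sub' (hi1.const_mul c).integrableOn (hi3.const_mul a).integrableOn,
      integral_const_mul, integral_const_mul, hIic]
  have hH1 : H₁ f = (∫ x in Iic ξ, (f x ^ 2 + deriv f x ^ 2))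
      + ∫ x in Ioi ξ, (f x ^ 2 + deriv f x ^ 2) :=
    (intervalIntegral.integral_Iic_add_Ioi hi1.integrableOn hi1.integrableOn).symm
  have hH2 : H₂ n f = (∫ x in Iic ξ, density n (f x) (deriv f x))
      + ∫ x in Ioi ξ, density n (f x) (deriv f x) :=
    (intervalIntegral.integral_Iic_add_Ioi hi2.integrableOn hi2.integrableOn).symm
  -- Comes from `1/2 - 1/(2n+1) = (2n-1)/(2(2n+1))`.
  have hpξ : 2 * (a * p ξ) = (2 * (n : ℝ) - 1) * a / (2 * (n : ℝ) + 1) * M ^ (2 * n + 1) := by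
    have h1 : M ^ (2 * n + 1) = M ^ (2 * n - 1) * M ^ 2 := by
      rw [← pow_add]
      congr 1
      omega
    simp only [hp, ← hM, h1]
    field_simp
    ring
  rw [hH1, hH2, ← hpξ]
  linarith

end Static

theorem BesselLift.integrable_sq {s : ℝ} {f : ℝ → ℝ} {F : Lp ℂ 2 (volume : Measure ℝ)}
    (h : BesselLift s f F) : Integrable fun x => f x ^ 2 := by
  have h1 := h.1.norm.integrable_sq
  simpa using h1

end HOCH

end

theorem proposition1p3 (n : ℕ) (hn : 1 ≤ n) (s : ℝ) (hs : 5 / 2 < s)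
    (u₀ : ℝ → ℝ) (hu₀ : HOCH.MemHs s u₀) (hm₀ : ∀ x, 0 ≤ HOCH.momentum u₀ x)
    (T : ℝ) (hT : 0 < T) (u : ℝ → ℝ → ℝ) (hu : HOCH.IsStrongSolution n s T u₀ u) :
    ∀ t ∈ Set.Ico 0 T, ∃ M : ℝ, IsGreatest (Set.range (u t)) M ∧
      (2 * (n : ℝ) - 1) * (2 - HOCH.c₁ n) / (2 * (n : ℝ) + 1) * M ^ (2 * n + 1)
        - (2 - HOCH.c₁ n) / 2 * M ^ (2 * n - 1) * HOCH.H₁ (u t) + HOCH.H₂ n (u t) ≤ 0 := by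
  intro t ht
  obtain ⟨A, α, -, hA⟩ := hu.exists_uniform_holderC2Bound hs ht.2
  have hb := hA t ⟨ht.1, le_rfl⟩
  obtain ⟨U, -, hU⟩ := hu.regularity
  have hdom := HOCH.abs_deriv_le_of_momentum_nonneg hb.differentiable hb.differentiable_deriv
    hb.abs_le hb.abs_deriv_le (hu.momentum_nonneg hs hm₀ ht)
  have hlim := (hU t ht).tendsto_cocompact (by linarith) (hu.continuous t ht)
  obtain ⟨ξ, hξ⟩ := HOCH.exists_forall_le_of_tendsto_cocompact (hu.continuous t ht)
    (fun x => (abs_nonneg _).trans (hdom x)) hlim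
  exact ⟨u t ξ, ⟨⟨ξ, rfl⟩, by rintro _ ⟨x, rfl⟩; exact hξ x⟩,
    HOCH.max_inequality hn hb.differentiable hb.differentiable_deriv.continuous hdom
      (hU t ht).integrable_sq hlim hξ⟩
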